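/- Let $M$ be a monoid. An $M$-space is a topological space with a left action of $M$ by continuous maps. An $M$-set $P$ is projective if every $M$-equivariant surjection onto $P$ has an $M$-equivariant section. A projective $M$-CW complex is an $M$-space $X$ that is the inductive limit of a sequence of $M$-invariant subspaces $\emptyset=X_{-1}\subseteq X_0\subseteq X_1\subseteq\cdots$, where, for each $n\ge 0$, $X_n$ is a pushout of $X_{n-1}\leftarrow P_n\times S^{n-1}\hookrightarrow P_n\times B^n$ along an $M$-equivariant continuous map, with $P_n$ a discrete projective $M$-set and $M$ acting trivially on the ball $B^n$ and its boundary sphere $S^{n-1}$ (so $X_0=P_0$ is discrete). Its dimension $\dim X$ is the supremum of the $n$ with $P_n\neq\emptyset$ (it is $\infty$ if these are unbounded, and $-\infty$ if $X=\emptyset$). An $M$-homotopy is an $M$-equivariant continuous map $H\colon X\times[0,1]\to Y$, where $M$ acts trivially on $[0,1]$; $[X,Y]_M$ is the set of $M$-homotopy classes of $M$-equivariant continuous maps $X\to Y$. An $M$-homotopy equivalence is an $M$-equivariant continuous map with an $M$-equivariant continuous inverse up to $M$-homotopy. For $n\in\mathbb N\cup\{\infty\}$, an $M$-equivariant continuous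 map $k\colon Y\to Z$ is an $n$-equivalence if it induces a bijection on $\pi_q$ for $0\le q<n$ and, if $n<\infty$, a surjection on $\pi_n$, where $\pi_0$ is the set of path components and, for $q\geq 1$, the condition is on $\pi_q(Y,y)\to\pi_q(Z,k(y))$ for all $y\in Y$; it is a weak equivalence if it is an $\infty$-equivalence. (1) Let $X$ be a projective $M$-CW complex, $n\in\mathbb N\cup\{\infty\}$, and let $k\colon Y\to Z$ be an $M$-equivariant $n$-equivalence of $M$-spaces. Then the induced map $k_*\colon[X,Y]_M\to[X,Z]_M$ is a bijection if $\dim X<n$ or $n=\infty$, and a surjection if $\dim X=n<\infty$. (2) Let $Y$ and $Z$ be projective $M$-CW complexes and $k\colon Y\to Z$ an $M$-equivariant continuous map. If $k$ is a weak equivalence, or if $k$ is an $n$-equivalence for some $n\in\mathbb N$ with $\dim Y<n$ and $\dim Z<n$, then $k$ is an $M$-homotopy equivalence. -/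

import Mathlib

open CategoryTheory

universe u v

/-! ### Projective `M`-sets -/

/-- An `M`-set `P` is projective if every `M`-equivariant surjection onto `P` has an
`M`-equivariant section. (The universe `max u v` is large enough to contain the free `M`-sets
mapping onto `P` and copies of all `M`-sets in `Type u`.) -/
def IsProjectiveMSet (M : Type v) [Monoid M] (P : Type u) [MulAction M P] : Prop :=
  ∀ (Q : Type (max u v)) [MulAction M Q] (f : Q →[M] P), Function.Surjective f →
    ∃ s : P →[M] Q, ∀ p, f (s p) = p

/-! ### Projective `M`-CW complexes -/

/-- The closed unit ball `B^n` of `ℝ^n`. -/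
abbrev CWBall (n : ℕ) : Type := ↥(Metric.closedBall (0 : EuclideanSpace ℝ (Fin n)) 1)

/-- The unit sphere `S^{n-1}` of `ℝ^n`; it is empty for `n = 0`. -/
abbrev CWSphere (n : ℕ) : Type := ↥(Metric.sphere (0 : EuclideanSpace ℝ (Fin n)) 1)

/-- The inclusion of the sphere `S^{n-1}` in the ball `B^n`. -/
def cwSphereIncl (n : ℕ) : C(CWSphere n, CWBall n) :=
  ContinuousMap.inclusion Metric.sphere_subset_closedBall

/-- The structure of a projective `M`-CW complex on an `M`-space `X`.

The filtration is indexed so that `skel n` is the `(n-1)`-skeleton `X_{n-1}`: thus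
`skel 0 = X_{-1} = ∅`, and `skel (n + 1) = X_n` is obtained from `skel n = X_{n-1}` by attaching
`cell n × B^n` along `cell n × S^{n-1}`, where `cell n = P_n` is a (discrete) projective `M`-set and
`M` acts trivially on `B^n` and `S^{n-1}`. For `n = 0` this says that `X_0` is `P_0`
with the discrete topology. The space `X` is the inductive limit of its skeleta. -/
structure ProjectiveMCWComplex (M : Type v) [Monoid M] (X : Type u) [TopologicalSpace X]
    [MulAction M X] where
  /-- `skel n` is the `(n-1)`-skeleton -/
  skel : ℕ → Set X
  skel_zero : skel 0 = ∅
  skel_subset_succ : ∀ n, skel n ⊆ skel (n + 1)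
  smul_mem_skel : ∀ n (m : M), ∀ x ∈ skel n, m • x ∈ skel n
  iUnion_skel : ⋃ n, skel n = Set.univ
  /-- a set is open as soon as its trace on each skeleton is open in that skeleton -/
  isCoherentWith : Topology.IsCoherentWith (Set.range skel)
  /-- `cell n` is the `M`-set `P_n` of `n`-cells -/
  cell : ℕ → Type u
  cellAction : ∀ n, MulAction M (cell n)
  cellTopology : ∀ n, TopologicalSpace (cell n)
  cellDiscrete : ∀ n, DiscreteTopology (cell n)
  cellProjective : ∀ n, IsProjectiveMSet M (cell n)
  /-- the attaching maps of all `n`-cells together -/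
  attach : ∀ n, C(cell n × CWSphere n, skel n)
  attach_smul : ∀ n (m : M) (p : cell n) (s : CWSphere n),
    (attach n (m • p, s) : X) = m • (attach n (p, s) : X)
  /-- the characteristic maps of all `n`-cells together -/
  char : ∀ n, C(cell n × CWBall n, skel (n + 1))
  char_smul : ∀ n (m : M) (p : cell n) (b : CWBall n),
    (char n (m • p, b) : X) = m • (char n (p, b) : X)
  /-- the `n`-skeleton is the pushout of the `(n-1)`-skeleton and `P_n × B^n` -/
  isPushout : ∀ n, IsPushout
    (TopCat.ofHom (attach n))
    (TopCat.ofHom ((ContinuousMap.id (cell n)).prodMap (cwSphereIncl n)))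
    (TopCat.ofHom (ContinuousMap.inclusion (skel_subset_succ n)))
    (TopCat.ofHom (char n))

attribute [instance] ProjectiveMCWComplex.cellAction ProjectiveMCWComplex.cellTopology
  ProjectiveMCWComplex.cellDiscrete

/-- The dimension of a projective `M`-CW complex: the supremum of the dimensions of its cells
(`⊤` if these are unbounded, `⊥` if there is no cell, that is, if `X` is empty). -/
noncomputable def ProjectiveMCWComplex.dim {M : Type v} [Monoid M] {X : Type u}
    [TopologicalSpace X] [MulAction M X] (c : ProjectiveMCWComplex M X) : WithBot ℕ∞ :=
  ⨆ n ∈ {n : ℕ | Nonempty (c.cell n)}, ((n : ℕ∞) : WithBot ℕ∞)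

/-! ### Equivariant maps and homotopies -/

/-- `M`-equivariant continuous maps `X → Y`. -/
structure MMap (M : Type v) [Monoid M] (X Y : Type u) [TopologicalSpace X] [TopologicalSpace Y]
    [MulAction M X] [MulAction M Y] extends C(X, Y) where
  map_smul' : ∀ (m : M) (x : X), toFun (m • x) = m • toFun x

namespace MMap

variable {M : Type v} [Monoid M] {X Y Z : Type u}
  [TopologicalSpace X] [TopologicalSpace Y] [TopologicalSpace Z]
  [MulAction M X] [MulAction M Y] [MulAction M Z]

/-- The identity map. -/
def id (M : Type v) [Monoid M] (X : Type u) [TopologicalSpace X] [MulAction M X] : MMap M X X where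
  toContinuousMap := ContinuousMap.id X
  map_smul' _ _ := rfl

/-- The composite `g ∘ f`. -/
def comp (g : MMap M Y Z) (f : MMap M X Y) : MMap M X Z where
  toContinuousMap := g.toContinuousMap.comp f.toContinuousMap
  map_smul' m x := (congrArg g.toFun (f.map_smul' m x)).trans (g.map_smul' m (f.toFun x))

/-- `f` and `g` are `M`-homotopic: there is a homotopy from `f` to `g` which is equivariant
for the action of `M` on `X` and the trivial action on the unit interval. -/
def Homotopic (f g : MMap M X Y) : Prop :=
  ContinuousMap.HomotopicWith f.toContinuousMap g.toContinuousMap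
    (fun h => ∀ (m : M) (x : X), h (m • x) = m • h x)

theorem homotopic_equivalence : Equivalence (Homotopic (M := M) (X := X) (Y := Y)) where
  refl f := ContinuousMap.HomotopicWith.refl _ f.map_smul'
  symm h := ContinuousMap.HomotopicWith.symm h
  trans h h' := ContinuousMap.HomotopicWith.trans h h'

theorem Homotopic.comp_left (k : MMap M Y Z) {f g : MMap M X Y} (h : f.Homotopic g) :
    (k.comp f).Homotopic (k.comp g) := by
  obtain ⟨H⟩ := h
  refine ⟨⟨(ContinuousMap.Homotopy.refl k.toContinuousMap).comp H.toHomotopy, ?_⟩⟩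
  intro t m x
  exact (congrArg k.toFun (H.prop t m x)).trans (k.map_smul' m _)

instance homotopySetoid (M : Type v) [Monoid M] (X Y : Type u)
    [TopologicalSpace X] [TopologicalSpace Y] [MulAction M X] [MulAction M Y] :
    Setoid (MMap M X Y) :=
  ⟨Homotopic, homotopic_equivalence⟩

/-- `k` is an `M`-homotopy equivalence. -/
def IsHomotopyEquiv (k : MMap M Y Z) : Prop :=
  ∃ g : MMap M Z Y, (g.comp k).Homotopic (MMap.id M Y) ∧ (k.comp g).Homotopic (MMap.id M Z)

end MMap

/-- `[X, Y]_M`, the set of `M`-homotopy classes of `M`-equivariant continuous maps `X → Y`. -/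
def MHomotopyClasses (M : Type v) [Monoid M] (X Y : Type u) [TopologicalSpace X]
    [TopologicalSpace Y] [MulAction M X] [MulAction M Y] : Type u :=
  Quotient (MMap.homotopySetoid M X Y)

/-- The map `k_* : [X, Y]_M → [X, Z]_M` of composition with `k : Y → Z`. -/
def MHomotopyClasses.push {M : Type v} [Monoid M] (X : Type u) {Y Z : Type u}
    [TopologicalSpace X] [TopologicalSpace Y] [TopologicalSpace Z]
    [MulAction M X] [MulAction M Y] [MulAction M Z] (k : MMap M Y Z) :
    MHomotopyClasses M X Y → MHomotopyClasses M X Z :=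
  Quotient.map k.comp fun _ _ h => MMap.Homotopic.comp_left k h

/-! ### `n`-equivalences -/

/-- The map induced by `f` on sets of path components. -/
def pathComponentsMap {Y Z : Type u} [TopologicalSpace Y] [TopologicalSpace Z] (f : C(Y, Z)) :
    ZerothHomotopy Y → ZerothHomotopy Z :=
  Quotient.map f fun _ _ h => Joined.map h f.continuous

/-- The map `π_q(Y, y) → π_q(Z, f y)` induced by `f`. -/
def homotopyGroupMap {Y Z : Type u} [TopologicalSpace Y] [TopologicalSpace Z] (f : C(Y, Z))
    (q : ℕ) (y : Y) : HomotopyGroup (Fin q) Y y → HomotopyGroup (Fin q) Z (f y) :=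
  Quotient.map
    (fun γ : GenLoop (Fin q) Y y => (⟨f.comp γ.1, fun t ht => congrArg f (γ.2 t ht)⟩ :
      GenLoop (Fin q) Z (f y)))
    fun _ _ h => ContinuousMap.HomotopicRel.comp_continuousMap h f

/-- `f` is an `n`-equivalence: it induces bijections on `π_q` for `q < n` and surjections for
`q = n`, at all base points. The condition on `π_0`, the set of path components, does not refer to
a base point, and is imposed also when `Y` is empty. A weak equivalence is a `⊤`-equivalence. -/
def IsNEquivalence (n : ℕ∞) {Y Z : Type u} [TopologicalSpace Y] [TopologicalSpace Z]
    (f : C(Y, Z)) : Prop :=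
  (0 < n → Function.Bijective (pathComponentsMap f)) ∧
  (n = 0 → Function.Surjective (pathComponentsMap f)) ∧
  ∀ q : ℕ, 1 ≤ q → ∀ y : Y,
    ((q : ℕ∞) < n → Function.Bijective (homotopyGroupMap f q y)) ∧
    ((q : ℕ∞) = n → Function.Surjective (homotopyGroupMap f q y))

/-- A weak equivalence induces bijections on path components and on all homotopy groups. -/
def IsWeakEquivalence {Y Z : Type u} [TopologicalSpace Y] [TopologicalSpace Z]
    (f : C(Y, Z)) : Prop :=
  IsNEquivalence ⊤ f

open scoped unitInterval

/-! ### Relative lifting and equivariant lifting from projective `M`-CW complexes -/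

/-! Replace `k` by the projection `MapPath.start` from its mapping path space, with the
componentwise action of `M`. A lift of `f : X → Z` through it is a map `g : X → Y` together with an
`M`-homotopy from `f` to `k ∘ g`, so surjectivity of `k_*` is a lifting problem for `X`. Injectivity
is a lifting problem as well: a homotopy between `k ∘ g₀` and `k ∘ g₁` is to be lifted with
prescribed ends, that is, through `PathWithEnds.ofPath`. There a cell of dimension `q` poses a
problem for `start` on a ball of dimension `q + 1`, whence the bound `dim X < n` instead of `dim X ≤
n`.

Lifts are built cell by cell (`ProjectiveMCWComplex.exists_lift`). Projectivity removes equivariance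
from the problem: a projective `M`-set is a retract of a free one, so lifts can be chosen on single
balls without any equivariance and then spread by the action (`exists_equivariant_lift_cells`).

What remains is classical: for an `n`-equivalence, `start` has the lifting property for `(B^q,
S^{q-1})` with `q ≤ n` (`IsNEquivalence.hasLift_start`). Homotopy lifting reduces this to data whose
paths over the boundary are constant. For `q > 0`, a collapse of a cube onto the ball turns such
data into a path of generalized loops of dimension `q - 1`; injectivity on `π_{q-1}` and
surjectivity on `π_q` lift this path up to homotopy (`exists_cube_lift`). Part (2) then follows
formally from part (1). -/

/-- Every map `D → B` together with a lift through `p` on the subset `S` has a lift on `D`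
extending the given one. -/
def HasLift {A B : Type*} [TopologicalSpace A] [TopologicalSpace B] (p : C(A, B))
    (D : Type*) [TopologicalSpace D] (S : Set D) : Prop :=
  ∀ (f : C(D, B)) (e : C(S, A)), (∀ s, p (e s) = f s) →
    ∃ g : C(D, A), (∀ x, p (g x) = f x) ∧ ∀ s : S, g s = e s

/-- The boundary sphere as a subset of the ball. -/
def ballBoundary (n : ℕ) : Set (CWBall n) := Set.range (cwSphereIncl n)

theorem mem_ballBoundary {n : ℕ} {x : CWBall n} : x ∈ ballBoundary n ↔ ‖x.1‖ = 1 := by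
  constructor
  · rintro ⟨s, rfl⟩
    exact mem_sphere_zero_iff_norm.1 s.2
  · intro h
    exact ⟨⟨x.1, mem_sphere_zero_iff_norm.2 h⟩, rfl⟩

theorem HasLift.exists_ball_lift {A B : Type*} [TopologicalSpace A] [TopologicalSpace B]
    {p : C(A, B)} {n : ℕ} (hp : HasLift p (CWBall n) (ballBoundary n))
    (f : C(CWBall n, B)) (e : C(CWSphere n, A)) (h : ∀ s, p (e s) = f (cwSphereIncl n s)) :
    ∃ g : C(CWBall n, A), (∀ x, p (g x) = f x) ∧ ∀ s, g (cwSphereIncl n s) = e s := by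
  let j : C(ballBoundary n, CWSphere n) :=
    ⟨fun x => ⟨x.1.1, mem_sphere_zero_iff_norm.2 (mem_ballBoundary.1 x.2)⟩, by fun_prop⟩
  obtain ⟨g, hg, hg'⟩ := hp f (e.comp j) fun s => h (j s)
  exact ⟨g, hg, fun s => hg' ⟨cwSphereIncl n s, s, rfl⟩⟩

/-- A projective `M`-set is an equivariant retract of a free one. -/
theorem IsProjectiveMSet.exists_retraction {M : Type v} [Monoid M] {P : Type u} [MulAction M P]
    (hP : IsProjectiveMSet M P) :
    ∃ (π : P → P) (μ : P → M), (∀ p, μ p • π p = p) ∧ (∀ (m : M) p, π (m • p) = π p) ∧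
      ∀ (m : M) p, μ (m • p) = m * μ p := by
  -- The test object is the free `M`-set on the underlying set of `P`; the two components of a
  -- section are `π` and `μ`.
  obtain ⟨s, hs⟩ := hP (Σ _ : P, M)
    { toFun := fun x => x.2 • x.1
      map_smul' := fun m x => mul_smul m x.2 x.1 }
    fun p => ⟨⟨p, 1⟩, one_smul M p⟩
  have h (m : M) (p : P) : s (m • p) = ⟨(s p).1, m * (s p).2⟩ := map_smul s m p
  exact ⟨fun p => (s p).1, fun p => (s p).2, hs, fun m p => by simp only [h],
    fun m p => by simp only [h]⟩

/-- Lift on one ball for each point of `P`, with no compatibility between the choices, but use only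
the lifts at the points `π x`. Since `π` is invariant and `μ` is equivariant, translating by `μ x`
produces an equivariant family, and `μ x • π x = x` puts it over `f`. -/
theorem exists_equivariant_lift_cells {M : Type v} [Monoid M] {P A B : Type*} [MulAction M P]
    [TopologicalSpace P] [DiscreteTopology P] [TopologicalSpace A] [TopologicalSpace B]
    [MulAction M A] [MulAction M B] [ContinuousConstSMul M A]
    (hP : IsProjectiveMSet M P) {p : C(A, B)} (hpM : ∀ (m : M) a, p (m • a) = m • p a) {n : ℕ}
    (hp : Nonempty P → HasLift p (CWBall n) (ballBoundary n))
    (f : C(P × CWBall n, B)) (hf : ∀ (m : M) x b, f (m • x, b) = m • f (x, b))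
    (e : C(P × CWSphere n, A)) (he : ∀ (m : M) x b, e (m • x, b) = m • e (x, b))
    (h : ∀ x s, p (e (x, s)) = f (x, cwSphereIncl n s)) :
    ∃ g : C(P × CWBall n, A), (∀ (m : M) x b, g (m • x, b) = m • g (x, b)) ∧
      (∀ x, p (g x) = f x) ∧ ∀ x s, g (x, cwSphereIncl n s) = e (x, s) := by
  obtain ⟨π, μ, hπμ, hπ, hμ⟩ := hP.exists_retraction
  have H (x : P) := (hp ⟨x⟩).exists_ball_lift
    (f.comp ((ContinuousMap.const _ x).prodMk (ContinuousMap.id _)))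
    (e.comp ((ContinuousMap.const _ x).prodMk (ContinuousMap.id _))) (h x)
  choose G hG hG' using H
  refine ⟨⟨fun y => μ y.1 • G (π y.1) y.2, ?_⟩, ?_, ?_, ?_⟩
  · rw [continuous_prod_of_discrete_left]
    exact fun x => (G (π x)).continuous.const_smul (μ x)
  · intro m x b
    simp [hπ, hμ, mul_smul]
  · rintro ⟨x, b⟩
    have : p (G (π x) b) = f (π x, b) := hG (π x) b
    simp [hpM, this, ← hf, hπμ]
  · intro x s
    have : G (π x) (cwSphereIncl n s) = e (π x, s) := hG' (π x) s
    simp [this, ← he, hπμ]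

namespace ProjectiveMCWComplex

variable {M : Type v} [Monoid M] {X : Type u} [TopologicalSpace X] [MulAction M X]
  (c : ProjectiveMCWComplex M X)

theorem attach_eq (n : ℕ) (x : c.cell n) (s : CWSphere n) :
    (c.char n (x, cwSphereIncl n s) : X) = c.attach n (x, s) := by
  have := congrArg (fun k => (k.hom (x, s)).1) (c.isPushout n).w
  exact this.symm

theorem skel_ext {A : Type u} [TopologicalSpace A] {n : ℕ} {g g' : C(c.skel (n + 1), A)}
    (h : ∀ x : c.skel n, g ⟨x, c.skel_subset_succ n x.2⟩ = g' ⟨x, c.skel_subset_succ n x.2⟩)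
    (h' : ∀ x, g (c.char n x) = g' (c.char n x)) : g = g' := by
  have : TopCat.ofHom g = TopCat.ofHom g' := (c.isPushout n).hom_ext
    (by ext x; exact h x) (by ext x; exact h' x)
  exact congrArg TopCat.Hom.hom this

theorem exists_desc {A : Type u} [TopologicalSpace A] {n : ℕ} (g : C(c.skel n, A))
    (G : C(c.cell n × CWBall n, A)) (h : ∀ x s, G (x, cwSphereIncl n s) = g (c.attach n (x, s))) :
    ∃ g' : C(c.skel (n + 1), A), (∀ x : c.skel n, g' ⟨x, c.skel_subset_succ n x.2⟩ = g x) ∧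
      ∀ x, g' (c.char n x) = G x := by
  have w : TopCat.ofHom (c.attach n) ≫ TopCat.ofHom g =
      TopCat.ofHom ((ContinuousMap.id (c.cell n)).prodMap (cwSphereIncl n)) ≫ TopCat.ofHom G := by
    ext x
    exact (h x.1 x.2).symm
  refine ⟨((c.isPushout n).desc _ _ w).hom, fun x => ?_, fun x => ?_⟩
  · exact congrArg (fun k => k.hom x) ((c.isPushout n).inl_desc _ _ w)
  · exact congrArg (fun k => k.hom x) ((c.isPushout n).inr_desc _ _ w)

variable {A B : Type u} [TopologicalSpace A] [TopologicalSpace B]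
    [MulAction M A] [MulAction M B] [ContinuousConstSMul M A]

/-- An equivariant lift of `f` over a skeleton. -/
structure SkelLift (p : C(A, B)) (f : C(X, B)) (n : ℕ) where
  toMap : C(c.skel n, A)
  smul : ∀ (m : M) (x : c.skel n), toMap ⟨m • x.1, c.smul_mem_skel n m x x.2⟩ = m • toMap x
  lift : ∀ x, p (toMap x) = f x

/-- The lift on the new cells and the old lift are glued by the pushout property. Its uniqueness
part then shows that the glued map is equivariant and lies over `f`, as both identities hold on the
old skeleton and on the cells. -/
theorem exists_skelLift_succ [ContinuousConstSMul M X] [ContinuousConstSMul M B] {p : C(A, B)}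
    (hpM : ∀ (m : M) a, p (m • a) = m • p a) {n : ℕ}
    (hp : Nonempty (c.cell n) → HasLift p (CWBall n) (ballBoundary n))
    (f : C(X, B)) (hf : ∀ (m : M) x, f (m • x) = m • f x) (g : c.SkelLift p f n) :
    ∃ g' : c.SkelLift p f (n + 1),
      ∀ x : c.skel n, g'.toMap ⟨x, c.skel_subset_succ n x.2⟩ = g.toMap x := by
  obtain ⟨G, hGM, hG, hG'⟩ := exists_equivariant_lift_cells (c.cellProjective n) hpM hp
    (f.comp ((ContinuousMap.restrict (c.skel (n + 1)) (ContinuousMap.id X)).comp (c.char n)))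
    (fun m x b => by simp [c.char_smul, hf]) (g.toMap.comp (c.attach n))
    (fun m x b => by
      rw [ContinuousMap.comp_apply, ContinuousMap.comp_apply, ← g.smul]
      congr 1
      exact Subtype.ext (c.attach_smul n m x b))
    (fun x s => by simp [g.lift, c.attach_eq])
  obtain ⟨g', h₁, h₂⟩ := c.exists_desc g.toMap G hG'
  have hact (m : M) : Continuous fun x : c.skel (n + 1) =>
      (⟨m • x.1, c.smul_mem_skel _ m x x.2⟩ : c.skel (n + 1)) :=
    (continuous_subtype_val.const_smul m).subtype_mk _
  refine ⟨⟨g', ?_, ?_⟩, h₁⟩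
  · intro m x
    have : g'.comp ⟨_, hact m⟩ = m • g' := by
      refine c.skel_ext ?_ ?_
      · intro x
        simp only [ContinuousMap.comp_apply, ContinuousMap.coe_mk, ContinuousMap.smul_apply]
        rw [h₁, ← g.smul]
        exact h₁ ⟨m • x.1, c.smul_mem_skel _ m x x.2⟩
      · rintro ⟨x, b⟩
        simp only [ContinuousMap.comp_apply, ContinuousMap.coe_mk, ContinuousMap.smul_apply]
        rw [h₂, ← hGM, ← h₂]
        congr 1
        exact Subtype.ext (c.char_smul n m x b).symm
    exact congrArg (fun k => k x) this
  · intro x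
    have : p.comp g' = f.comp (ContinuousMap.restrict (c.skel (n + 1)) (ContinuousMap.id X)) := by
      refine c.skel_ext ?_ ?_
      · intro x
        simp [h₁, g.lift]
      · intro x
        simp only [ContinuousMap.comp_apply, h₂]
        exact hG x
    exact congrArg (fun k => k x) this

/-- Iterating the extension step from the empty skeleton gives compatible lifts; their union is
continuous because `X` carries the colimit topology. -/
theorem exists_lift [ContinuousConstSMul M X] [ContinuousConstSMul M B] {p : C(A, B)}
    (hpM : ∀ (m : M) a, p (m • a) = m • p a)
    (hp : ∀ n, Nonempty (c.cell n) → HasLift p (CWBall n) (ballBoundary n))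
    (f : C(X, B)) (hf : ∀ (m : M) x, f (m • x) = m • f x) :
    ∃ g : C(X, A), (∀ (m : M) x, g (m • x) = m • g x) ∧ ∀ x, p (g x) = f x := by
  choose F hF using fun n => c.exists_skelLift_succ hpM (hp n) f hf
  have h₀ : IsEmpty (c.skel 0) := by simp [c.skel_zero]
  let G : ∀ n, c.SkelLift p f n := fun n => Nat.rec
    ⟨⟨fun x => isEmptyElim x, by fun_prop⟩, fun _ x => isEmptyElim x, fun x => isEmptyElim x⟩ F n
  have hG (n : ℕ) (x : c.skel n) : (G (n + 1)).toMap ⟨x, c.skel_subset_succ n x.2⟩ =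
      (G n).toMap x := hF n (G n) x
  have hmono : Monotone c.skel := monotone_nat_of_le_succ c.skel_subset_succ
  have hG' {m n : ℕ} (h : m ≤ n) (x : c.skel m) :
      (G n).toMap ⟨x, hmono h x.2⟩ = (G m).toMap x := by
    induction n, h using Nat.le_induction with
    | base => rfl
    | succ n h ih => rw [← ih]; exact hG n ⟨x, hmono h x.2⟩
  have hex (x : X) : ∃ n, x ∈ c.skel n := by
    simpa using c.iUnion_skel.ge (Set.mem_univ x)
  choose N hN using hex
  let g : X → A := fun x => (G (N x)).toMap ⟨x, hN x⟩
  have hg (n : ℕ) (x : c.skel n) : g x = (G n).toMap x := by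
    rcases le_total (N x) n with h | h
    · exact (hG' h ⟨x, hN x⟩).symm
    · exact hG' h x
  refine ⟨⟨g, ⟨fun U hU => ?_⟩⟩, fun m x => ?_, fun x => (G (N x)).lift ⟨x, hN x⟩⟩
  · refine c.isCoherentWith.isOpen_of_forall_induced _ ?_
    rintro _ ⟨n, rfl⟩
    convert hU.preimage (G n).toMap.continuous using 1
    ext x
    simp [hg]
  · exact (hg (N x) ⟨m • x, c.smul_mem_skel _ m x (hN x)⟩).trans ((G (N x)).smul m ⟨x, hN x⟩)

end ProjectiveMCWComplex

/-! ### Lifting problems for pairs -/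

theorem HasLift.of_homeomorph {A B D D' : Type*} [TopologicalSpace A] [TopologicalSpace B]
    [TopologicalSpace D] [TopologicalSpace D'] {p : C(A, B)} {S : Set D} {S' : Set D'}
    (h : HasLift p D' S') (Φ : D ≃ₜ D') (hΦ : ∀ x, x ∈ S ↔ Φ x ∈ S') : HasLift p D S := by
  intro f e he
  have hΦ' (x : D') (hx : x ∈ S') : Φ.symm x ∈ S := by simpa [hΦ] using hx
  obtain ⟨g, hg, hg'⟩ := h (f.comp ⟨Φ.symm, Φ.symm.continuous⟩)
    (e.comp ⟨fun x => ⟨Φ.symm x.1, hΦ' x.1 x.2⟩,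
      (Φ.symm.continuous.comp continuous_subtype_val).subtype_mk _⟩) (fun s => he _)
  refine ⟨g.comp ⟨Φ, Φ.continuous⟩, fun x => ?_, fun s => ?_⟩
  · simp [hg]
  · have := hg' ⟨Φ s, (hΦ s).1 s.2⟩
    simp only [ContinuousMap.comp_apply, ContinuousMap.coe_mk] at this ⊢
    rw [this]
    congr 1
    exact Subtype.ext (by simp)

/-- Continuous maps on two closed sets which agree on the intersection can be glued. -/
theorem exists_glue {D A : Type*} [TopologicalSpace D] [TopologicalSpace A] {S T : Set D}
    (hS : IsClosed S) (hT : IsClosed T) (a : C(S, A)) (b : C(T, A))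
    (h : ∀ x (hs : x ∈ S) (ht : x ∈ T), a ⟨x, hs⟩ = b ⟨x, ht⟩) :
    ∃ e : C(↥(S ∪ T), A), (∀ x : S, e ⟨x, Or.inl x.2⟩ = a x) ∧
      ∀ x : T, e ⟨x, Or.inr x.2⟩ = b x := by
  classical
  let e : ↥(S ∪ T) → A := fun x =>
    if hs : x.1 ∈ S then a ⟨x, hs⟩ else b ⟨x, x.2.resolve_left hs⟩
  have h₁ (x : S) : e ⟨x, Or.inl x.2⟩ = a x := by simp [e]
  have h₂ (x : T) : e ⟨x, Or.inr x.2⟩ = b x := by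
    by_cases hs : x.1 ∈ S
    · simp only [e, dif_pos hs]
      exact h _ hs x.2
    · simp [e, hs]
  refine ⟨⟨e, continuous_iff_isClosed.2 fun C hC => ?_⟩, h₁, h₂⟩
  have e₁ := (hS.isClosedEmbedding_subtypeVal.isClosedMap _ (hC.preimage a.continuous))
  have e₂ := (hT.isClosedEmbedding_subtypeVal.isClosedMap _ (hC.preimage b.continuous))
  convert (e₁.union e₂).preimage (continuous_subtype_val (p := fun x => x ∈ S ∪ T)) using 1
  ext ⟨x, hx⟩
  constructor
  · intro hxC
    rcases hx with hx | hx
    · exact Or.inl ⟨⟨x, hx⟩, by rw [Set.mem_preimage, ← h₁]; exact hxC, rfl⟩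
    · exact Or.inr ⟨⟨x, hx⟩, by rw [Set.mem_preimage, ← h₂]; exact hxC, rfl⟩
  · rintro (⟨y, hy, rfl⟩ | ⟨y, hy, rfl⟩)
    · exact Set.mem_preimage.2 (by rw [h₁]; exact hy)
    · exact Set.mem_preimage.2 (by rw [h₂]; exact hy)

/-- Two convex bodies of the same dimension are homeomorphic by a homeomorphism preserving the
boundary. -/
theorem exists_homeomorph_convexBody {V W : Type*} [NormedAddCommGroup V] [NormedSpace ℝ V]
    [NormedAddCommGroup W] [NormedSpace ℝ W] [FiniteDimensional ℝ V] [FiniteDimensional ℝ W]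
    (hVW : Module.finrank ℝ V = Module.finrank ℝ W) {s : Set V} {t : Set W}
    (hs : IsClosed s) (hsc : Convex ℝ s) (hsb : Bornology.IsBounded s)
    (hsi : (interior s).Nonempty)
    (ht : IsClosed t) (htc : Convex ℝ t) (htb : Bornology.IsBounded t)
    (hti : (interior t).Nonempty) :
    ∃ Φ : s ≃ₜ t, ∀ x : s, x.1 ∈ frontier s ↔ (Φ x).1 ∈ frontier t := by
  let L : V ≃L[ℝ] W := ContinuousLinearEquiv.ofFinrankEq hVW
  have hfr : frontier (L.toHomeomorph '' s) = L.toHomeomorph '' frontier s :=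
    (L.toHomeomorph.image_frontier s).symm
  obtain ⟨e, -, he, he'⟩ := exists_homeomorph_image_eq (s := L.toHomeomorph '' s) (t := t)
    (hsc.linear_image (L : V →ₗ[ℝ] W))
    (by rw [← L.toHomeomorph.image_interior]; exact hsi.image _)
    ((NormedSpace.isVonNBounded_of_isBounded ℝ hsb).image (L : V →L[ℝ] W)) htc hti
    (NormedSpace.isVonNBounded_of_isBounded ℝ htb)
  rw [(L.toHomeomorph.isClosed_image.2 hs).closure_eq, ht.closure_eq] at he
  rw [hfr] at he'
  let Ψ : V ≃ₜ W := L.toHomeomorph.trans e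
  have h₁ : Ψ '' s = t := by rw [← he, ← Set.image_comp]; rfl
  have h₂ : Ψ '' frontier s = frontier t := by rw [← he', ← Set.image_comp]; rfl
  refine ⟨(Ψ.image s).trans (Homeomorph.setCongr h₁), fun x => ?_⟩
  rw [← h₂]
  exact (Ψ.injective.mem_set_image).symm

/-- `p` has the homotopy lifting property. -/
def HasHLP {A B : Type*} [TopologicalSpace A] [TopologicalSpace B] (p : C(A, B)) : Prop :=
  ∀ (T : Type) [TopologicalSpace T] (F : C(T × I, B)) (e : C(T, A)), (∀ x, p (e x) = F (x, 0)) →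
    ∃ G : C(T × I, A), (∀ x, p (G x) = F x) ∧ ∀ x, G (x, 0) = e x

/-- The side and the bottom of the cylinder over the ball form a strong deformation retract; `R` is
the deformation, which reaches `x` at time `τ x`. -/
theorem exists_cylinder_deformation (n : ℕ) :
    ∃ (R : C((CWBall n × I) × I, CWBall n × I)) (τ : C(CWBall n × I, I)),
      (∀ x, (R (x, 0)).1 ∈ ballBoundary n ∨ (R (x, 0)).2 = 0) ∧ (∀ x, R (x, τ x) = x) ∧
      ∀ x, x.1 ∈ ballBoundary n ∨ x.2 = 0 → τ x = 0 := by
  -- Radial projection from the point at height 2 on the axis. Scaling by `1 / μ` moves `x` along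
  -- its ray to the side or the bottom, whichever is met first. At time `s` the factor is `(1 - s) /
  -- μ`, which equals 1 at `s = 1 - μ`, the value of `τ`. The `min` in `b` keeps the height in `[0,
  -- 1]`.
  let μ : CWBall n × I → ℝ := fun x => max ‖x.1.1‖ (1 - x.2.1 / 2)
  have hμc : Continuous μ := by fun_prop
  have hμ (x) : 1 / 2 ≤ μ x := le_max_of_le_right (by linarith [x.2.2.2])
  have hμ₀ (x) : 0 < μ x := by linarith [hμ x]
  have hball (x : CWBall n × I) : ‖x.1.1‖ ≤ 1 := mem_closedBall_zero_iff.1 x.1.2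
  have hμ₁ (x) : μ x ≤ 1 := max_le (hball x) (by linarith [x.2.2.1])
  have hv (x : CWBall n × I) : ‖x.1.1‖ ≤ μ x := le_max_left _ _
  have ht (x : CWBall n × I) : 1 - x.2.1 / 2 ≤ μ x := le_max_right _ _
  let a : (CWBall n × I) × I → EuclideanSpace ℝ (Fin n) := fun y =>
    ((1 - y.2.1) / μ y.1) • y.1.1.1
  let b : (CWBall n × I) × I → ℝ := fun y => min 1 (2 - (1 - y.2.1) * (2 - y.1.2.1) / μ y.1)
  have ha (y) : a y ∈ Metric.closedBall (0 : EuclideanSpace ℝ (Fin n)) 1 := by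
    rw [mem_closedBall_zero_iff, norm_smul, Real.norm_eq_abs,
      abs_of_nonneg (div_nonneg (by linarith [y.2.2.2]) (hμ₀ _).le), div_mul_eq_mul_div,
      div_le_one (hμ₀ _)]
    nlinarith [hv y.1, y.2.2.1, y.2.2.2, norm_nonneg y.1.1.1]
  have hb (y) : b y ∈ Set.Icc (0 : ℝ) 1 := by
    refine ⟨le_min zero_le_one ?_, min_le_left _ _⟩
    rw [sub_nonneg, div_le_iff₀ (hμ₀ _)]
    nlinarith [ht y.1, y.2.2.1, y.2.2.2, y.1.2.2.2]
  have hac : Continuous a := by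
    have : ∀ y : (CWBall n × I) × I, μ y.1 ≠ 0 := fun y => (hμ₀ _).ne'
    fun_prop (disch := assumption)
  have hbc : Continuous b := by
    have : ∀ y : (CWBall n × I) × I, μ y.1 ≠ 0 := fun y => (hμ₀ _).ne'
    fun_prop (disch := assumption)
  refine ⟨⟨fun y => (⟨a y, ha y⟩, ⟨b y, hb y⟩), by fun_prop⟩,
    ⟨fun x => ⟨1 - μ x, by linarith [hμ₁ x], by linarith [hμ₀ x]⟩, by fun_prop⟩, ?_, ?_, ?_⟩
  · intro x
    rcases le_total (1 - x.2.1 / 2) ‖x.1.1‖ with h | h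
    · left
      have hx : μ x = ‖x.1.1‖ := max_eq_left h
      rw [mem_ballBoundary]
      have : ‖x.1.1‖ ≠ 0 := by rw [← hx]; exact (hμ₀ x).ne'
      simp [a, hx, norm_smul, this]
    · right
      have hx : μ x = 1 - x.2.1 / 2 := max_eq_right h
      refine Subtype.ext ?_
      have h2 : (2 - x.2.1) / (1 - x.2.1 / 2) = 2 := by
        rw [div_eq_iff (by rw [← hx]; exact (hμ₀ x).ne')]; ring
      simp [b, hx, h2]
  · intro x
    have h1 := (hμ₀ x).ne'
    refine Prod.ext (Subtype.ext ?_) (Subtype.ext ?_)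
    · simp [a, h1]
    · simp [b, h1, x.2.2.2]
  · rintro x (h | h)
    · rw [mem_ballBoundary] at h
      refine Subtype.ext ?_
      have : μ x = 1 := le_antisymm (hμ₁ x) (h ▸ hv x)
      simp [this]
    · refine Subtype.ext ?_
      have : μ x = 1 := le_antisymm (hμ₁ x) (by have := ht x; simpa [h] using this)
      simp [this]

/-- Lift the homotopy `f ∘ R`, whose time 0 lies in the subset where a lift is given, and evaluate
at time `τ x`. On the subset `τ` vanishes, so the given lift is kept. -/
theorem HasHLP.hasLift_cylinder {A B : Type*} [TopologicalSpace A] [TopologicalSpace B]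
    {p : C(A, B)} (hp : HasHLP p) (n : ℕ) :
    HasLift p (CWBall n × I) ({x | x.1 ∈ ballBoundary n} ∪ {x | x.2 = 0}) := by
  intro f e he
  obtain ⟨R, τ, h₀, h₁, h₂⟩ := exists_cylinder_deformation n
  obtain ⟨G, hG, hG'⟩ := hp _ (f.comp R)
    (e.comp ⟨fun x => ⟨R (x, 0), h₀ x⟩, by fun_prop⟩) (fun x => he _)
  refine ⟨G.comp ((ContinuousMap.id _).prodMk τ), fun x => ?_, fun s => ?_⟩
  · exact (hG _).trans (congrArg f (h₁ x))
  · have hτ := h₂ s s.2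
    have := h₁ s
    rw [hτ] at this
    change G (s, τ s) = e s
    rw [hτ, hG']
    exact congrArg e (Subtype.ext this)

theorem isClosed_ballBoundary (n : ℕ) : IsClosed (ballBoundary n) := by
  have : ballBoundary n = {x | ‖x.1‖ = 1} := Set.ext fun x => mem_ballBoundary
  rw [this]
  exact isClosed_eq (by fun_prop) (by fun_prop)

theorem HasHLP.exists_cylinder_lift {A B : Type*} [TopologicalSpace A] [TopologicalSpace B]
    {p : C(A, B)} (hp : HasHLP p) {n : ℕ} (F : C(CWBall n × I, B)) (a : C(ballBoundary n × I, A))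
    (b : C(CWBall n, A)) (ha : ∀ s t, p (a (s, t)) = F (s, t)) (hb : ∀ x, p (b x) = F (x, 0))
    (hab : ∀ s, a (s, 0) = b s) :
    ∃ G : C(CWBall n × I, A), (∀ x, p (G x) = F x) ∧ (∀ s t, G (s.1, t) = a (s, t)) ∧
      ∀ x, G (x, 0) = b x := by
  obtain ⟨e, he, he'⟩ := exists_glue (S := {x : CWBall n × I | x.1 ∈ ballBoundary n})
    (T := {x | x.2 = 0}) ((isClosed_ballBoundary n).preimage continuous_fst)
    (isClosed_eq continuous_snd continuous_const)
    (a.comp ⟨fun x => (⟨x.1.1, x.2⟩, x.1.2), by fun_prop⟩)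
    (b.comp ⟨fun x => x.1.1, by fun_prop⟩)
    (by
      rintro ⟨x, t⟩ hs ht
      obtain rfl : t = 0 := ht
      exact hab ⟨x, hs⟩)
  obtain ⟨G, hG, hG'⟩ := hp.hasLift_cylinder n F e (by
    rintro ⟨⟨x, t⟩, hx⟩
    rcases hx with hx | hx
    · exact (congrArg p (he ⟨(x, t), hx⟩)).trans (ha ⟨x, hx⟩ t)
    · obtain rfl : t = 0 := hx
      exact (congrArg p (he' ⟨(x, 0), rfl⟩)).trans (hb x))
  refine ⟨G, hG, fun s t => ?_, fun x => ?_⟩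
  · exact (hG' ⟨(s.1, t), Or.inl s.2⟩).trans (he ⟨(s.1, t), s.2⟩)
  · exact (hG' ⟨(x, 0), Or.inr rfl⟩).trans (he' ⟨(x, 0), rfl⟩)

/-- Fed into `HasHLP.exists_cylinder_lift`, this trivial case is the homotopy extension property of
the ball relative to its boundary. -/
theorem hasHLP_punit (Z : Type*) [TopologicalSpace Z] :
    HasHLP (ContinuousMap.const Z PUnit.unit : C(Z, PUnit.{1})) := by
  intro T _ F e _
  exact ⟨e.comp ⟨Prod.fst, by fun_prop⟩, fun _ => rfl, fun _ => rfl⟩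

/-! ### The mapping path fibration -/

/-- The mapping path space of `k : Y → Z`: pairs of a point `y` of `Y` and a path in `Z` that ends
at `k y`. -/
abbrev MapPath {Y Z : Type*} [TopologicalSpace Y] [TopologicalSpace Z] (k : C(Y, Z)) : Type _ :=
  {e : Y × C(I, Z) // e.2 1 = k e.1}

namespace MapPath

variable {Y Z : Type*} [TopologicalSpace Y] [TopologicalSpace Z] (k : C(Y, Z))

/-- The starting point of the path. -/
def start : C(MapPath k, Z) :=
  ⟨fun e => e.1.2 0, (continuous_eval_const 0).comp (continuous_snd.comp continuous_subtype_val)⟩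

/-- The projection of the mapping path space to `Y`. -/
def base : C(MapPath k, Y) := ⟨fun e => e.1.1, continuous_fst.comp continuous_subtype_val⟩

/-- The point of the mapping path space given by a constant path. -/
def const : C(Y, MapPath k) :=
  ⟨fun y => ⟨(y, ContinuousMap.const I (k y)), rfl⟩,
    (continuous_id.prodMk (ContinuousMap.continuous_const'.comp k.continuous)).subtype_mk _⟩

variable {k}

/-- A map to the mapping path space from a family of paths. -/
theorem exists_map {T : Type*} [TopologicalSpace T] (g : C(T, Y)) (H : C(T × I, Z))
    (h : ∀ x, H (x, 1) = k (g x)) :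
    ∃ G : C(T, MapPath k), ∀ x, (G x).1.1 = g x ∧ ∀ t, (G x).1.2 t = H (x, t) :=
  ⟨⟨fun x => ⟨(g x, H.curry x), h x⟩,
    (g.continuous.prodMk H.curry.continuous).subtype_mk _⟩, fun _ => ⟨rfl, fun _ => rfl⟩⟩

theorem ext {e e' : MapPath k} (h : e.1.1 = e'.1.1) (h' : ∀ t, e.1.2 t = e'.1.2 t) : e = e' :=
  Subtype.ext (Prod.ext h (ContinuousMap.ext h'))

theorem continuous_eval {T : Type*} [TopologicalSpace T] {e : T → MapPath k} {t : T → I}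
    (he : Continuous e) (ht : Continuous t) : Continuous fun x => (e x).1.2 (t x) :=
  (continuous_snd.comp (continuous_subtype_val.comp he)).eval ht

/-- The lifted path at time `t` runs back along the homotopy from time `t` to time 0 and then
follows the old path. -/
theorem hasHLP_start : HasHLP (start k) := by
  intro T _ F e he
  -- An affine parametrization of `[-t, 1]`: negative values belong to the homotopy and positive
  -- ones to the old path.
  let r : (T × I) × I → ℝ := fun y => -y.1.2 + (1 + y.1.2) * y.2
  have hr : Continuous r := by fun_prop
  let H : (T × I) × I → Z := fun y =>
    if r y ≤ 0 then F (y.1.1, Set.projIcc 0 1 zero_le_one (-r y))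
    else (e y.1.1).1.2 (Set.projIcc 0 1 zero_le_one (r y))
  have hH : Continuous H := by
    refine Continuous.if_le ?_ ?_ hr continuous_const ?_
    · exact F.continuous.comp (by fun_prop)
    · exact continuous_eval (by fun_prop) (by fun_prop)
    · intro y hy
      simp only [hy, neg_zero, Set.projIcc_left]
      exact (he _).symm
  obtain ⟨G, hG⟩ := exists_map (k := k) ((base k).comp (e.comp ⟨Prod.fst, continuous_fst⟩))
    ⟨H, hH⟩ (by
      rintro ⟨x, t⟩
      have : r ((x, t), 1) = 1 := by simp [r]
      simp only [ContinuousMap.coe_mk, H, this]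
      simpa [not_le.2 (zero_lt_one' ℝ)] using! (e x).2)
  refine ⟨G, fun x => ?_, fun x => ?_⟩
  · refine ((hG x).2 0).trans ?_
    have : r (x, 0) = -x.2 := by simp [r]
    simp only [ContinuousMap.coe_mk, H, this]
    simp [x.2.2.1]
  · refine ext (hG _).1 fun t => ((hG _).2 t).trans ?_
    have : r ((x, 0), t) = t := by simp [r]
    simp only [ContinuousMap.coe_mk, H, this]
    by_cases ht : t = 0
    · subst ht
      simpa using! (he x).symm
    · have : ¬ (t : ℝ) ≤ 0 := fun h => ht (Subtype.ext (le_antisymm h t.2.1))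
      simp [this]

/-- Cutting off an initial segment of the path. -/
theorem exists_truncation (k : C(Y, Z)) : ∃ T : C(MapPath k × I, MapPath k),
    (∀ e, T (e, 0) = e) ∧ (∀ e, T (e, 1) = const k e.1.1) := by
  obtain ⟨T, hT⟩ := exists_map (k := k) ((base k).comp ⟨Prod.fst, continuous_fst⟩)
    (⟨fun y : (MapPath k × I) × I => y.1.1.1.2 (max y.1.2 y.2),
      continuous_eval (by fun_prop) (by fun_prop)⟩ : C((MapPath k × I) × I, Z))
    (fun x => by
      simp only [ContinuousMap.coe_mk]
      rw [max_eq_right (show x.2 ≤ 1 from x.2.2.2)]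
      exact x.1.2)
  refine ⟨T, fun e => ext (hT _).1 fun t => ((hT _).2 t).trans ?_,
    fun e => ext (hT _).1 fun t => ((hT _).2 t).trans ?_⟩
  · simp only [ContinuousMap.coe_mk]
    rw [max_eq_right (show 0 ≤ t from t.2.1)]
  · simp only [ContinuousMap.coe_mk]
    rw [max_eq_left (show t ≤ 1 from t.2.2)]
    exact e.2

/-- It suffices to solve lifting problems in which all paths on the boundary are constant. -/
theorem hasLift_start_of_const {n : ℕ}
    (h : ∀ (f : C(CWBall n, Z)) (g : C(ballBoundary n, Y)), (∀ s, k (g s) = f s) →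
      ∃ e : C(CWBall n, MapPath k), (∀ x, start k (e x) = f x) ∧
        ∀ s : ballBoundary n, e s = const k (g s)) :
    HasLift (start k) (CWBall n) (ballBoundary n) := by
  intro f e he
  obtain ⟨T, hT₀, hT₁⟩ := exists_truncation k
  let a : C(ballBoundary n × I, MapPath k) := T.comp (e.prodMap (ContinuousMap.id I))
  have ha₀ (s) : a (s, 0) = e s := hT₀ _
  have ha₁ (s) : a (s, 1) = const k (e s).1.1 := hT₁ _
  -- Truncation deforms `e` to constant paths on the boundary; `F` extends the resulting homotopy of
  -- starting points to the ball.
  obtain ⟨F, -, hF, hF'⟩ := (hasHLP_punit Z).exists_cylinder_lift (ContinuousMap.const _ _)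
    ((start k).comp a) f (fun _ _ => rfl) (fun _ => rfl)
    (fun s => (congrArg (start k) (ha₀ s)).trans (he s))
  obtain ⟨E, hE, hE'⟩ := h (F.comp ((ContinuousMap.id _).prodMk (ContinuousMap.const _ 1)))
    ((base k).comp e) (fun s => by
      change k (e s).1.1 = F (s, 1)
      rw [hF]
      exact congrArg (start k) (ha₁ s).symm)
  -- Lift the reversed homotopy, starting from the solution `E` of the deformed problem and
  -- following the reversed truncation on the boundary; its end solves the original problem.
  obtain ⟨G, hG, hGa, -⟩ := hasHLP_start.exists_cylinder_lift
    (F.comp ((ContinuousMap.id _).prodMap ⟨unitInterval.symm, by fun_prop⟩))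
    (a.comp ((ContinuousMap.id _).prodMap ⟨unitInterval.symm, by fun_prop⟩)) E
    (fun s t => (hF s _).symm) (fun x => by simpa using hE x)
    (fun s => by simpa using (ha₁ s).trans (hE' s).symm)
  refine ⟨G.comp ((ContinuousMap.id _).prodMk (ContinuousMap.const _ 1)), fun x => ?_, fun s => ?_⟩
  · refine (hG _).trans ?_
    simpa using hF' x
  · refine (hGa s 1).trans ?_
    simpa using ha₀ s

end MapPath

/-! ### Lifting homotopies -/

/-- Paths in the target of `p` with lifts of the two endpoints. -/
abbrev PathWithEnds {A B : Type*} [TopologicalSpace A] [TopologicalSpace B] (p : C(A, B)) : Type _ :=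
  {b : (A × A) × C(I, B) // p b.1.1 = b.2 0 ∧ p b.1.2 = b.2 1}

namespace PathWithEnds

variable {A B : Type*} [TopologicalSpace A] [TopologicalSpace B] (p : C(A, B))

/-- A path in the source of `p` gives a path in the target with lifts of the endpoints. -/
def ofPath : C(C(I, A), PathWithEnds p) :=
  ⟨fun γ => ⟨((γ 0, γ 1), p.comp γ), rfl, rfl⟩,
    (((continuous_eval_const 0).prodMk (continuous_eval_const 1)).prodMk
      (ContinuousMap.continuous_postcomp p)).subtype_mk _⟩

variable {p}

/-- By currying, a family of paths over the ball is a map on the cylinder. The prescribed ends give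
its lift on the top and the bottom, and `e` gives it on the side. -/
theorem hasLift_ofPath {n : ℕ}
    (hp : HasLift p (CWBall n × I)
      ({x | x.1 ∈ ballBoundary n} ∪ ({x | x.2 = 0} ∪ {x | x.2 = 1}))) :
    HasLift (ofPath p) (CWBall n) (ballBoundary n) := by
  intro f e he
  have he₀ (s) : e s 0 = (f s).1.1.1 := congrArg (fun b => b.1.1.1) (he s)
  have he₁ (s) : e s 1 = (f s).1.1.2 := congrArg (fun b => b.1.1.2) (he s)
  have het (s t) : p (e s t) = (f s).1.2 t := congrArg (fun b => b.1.2 t) (he s)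
  have hf : Continuous fun x => (f x).1 := continuous_subtype_val.comp f.continuous
  obtain ⟨a, ha₀, ha₁⟩ := exists_glue (S := {x : CWBall n × I | x.2 = 0}) (T := {x | x.2 = 1})
    (isClosed_eq continuous_snd continuous_const) (isClosed_eq continuous_snd continuous_const)
    (⟨fun x => (f x.1.1).1.1.1, by fun_prop⟩ : C(_, A)) ⟨fun x => (f x.1.1).1.1.2, by fun_prop⟩
    (fun x h₀ h₁ => absurd (h₀.symm.trans h₁) zero_ne_one)
  obtain ⟨b, hb, hb'⟩ := exists_glue (S := {x : CWBall n × I | x.1 ∈ ballBoundary n})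
    (T := {x | x.2 = 0} ∪ {x | x.2 = 1}) ((isClosed_ballBoundary n).preimage continuous_fst)
    ((isClosed_eq continuous_snd continuous_const).union
      (isClosed_eq continuous_snd continuous_const))
    (⟨fun x => e ⟨x.1.1, x.2⟩ x.1.2, (e.continuous.comp (by fun_prop)).eval (by fun_prop)⟩ :
      C({x : CWBall n × I | x.1 ∈ ballBoundary n}, A)) a (by
        rintro ⟨x, t⟩ hs (ht | ht)
        · obtain rfl : t = 0 := ht
          exact (he₀ ⟨x, hs⟩).trans (ha₀ ⟨(x, 0), rfl⟩).symm
        · obtain rfl : t = 1 := ht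
          exact (he₁ ⟨x, hs⟩).trans (ha₁ ⟨(x, 1), rfl⟩).symm)
  have hb₀ (x) : b ⟨(x, 0), Or.inr (Or.inl rfl)⟩ = (f x).1.1.1 :=
    (hb' ⟨(x, 0), Or.inl rfl⟩).trans (ha₀ ⟨(x, 0), rfl⟩)
  have hb₁ (x) : b ⟨(x, 1), Or.inr (Or.inr rfl)⟩ = (f x).1.1.2 :=
    (hb' ⟨(x, 1), Or.inr rfl⟩).trans (ha₁ ⟨(x, 1), rfl⟩)
  obtain ⟨G, hG, hG'⟩ := hp
    ⟨fun x => (f x.1).1.2 x.2, (continuous_snd.comp (hf.comp continuous_fst)).eval continuous_snd⟩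
    b (by
      rintro ⟨⟨x, t⟩, hx | ht | ht⟩
      · exact (congrArg p (hb ⟨(x, t), hx⟩)).trans (het ⟨x, hx⟩ t)
      · obtain rfl : t = 0 := ht
        exact (congrArg p (hb₀ x)).trans (f x).2.1
      · obtain rfl : t = 1 := ht
        exact (congrArg p (hb₁ x)).trans (f x).2.2)
  refine ⟨G.curry, fun x => ?_, fun s => ?_⟩
  · refine Subtype.ext (Prod.ext (Prod.ext ?_ ?_) (ContinuousMap.ext fun t => hG (x, t)))
    · exact (hG' ⟨(x, 0), Or.inr (Or.inl rfl)⟩).trans (hb₀ x)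
    · exact (hG' ⟨(x, 1), Or.inr (Or.inr rfl)⟩).trans (hb₁ x)
  · ext t
    exact (hG' ⟨(s.1, t), Or.inl s.2⟩).trans (hb ⟨(s.1, t), s.2⟩)

end PathWithEnds

/-- Both sides are convex bodies of dimension `n + 1`, and the frontier of the product consists of
the side, the bottom and the top. -/
theorem exists_homeomorph_ball_prod (n : ℕ) :
    ∃ Φ : CWBall n × I ≃ₜ CWBall (n + 1), ∀ x,
      x ∈ ({x | x.1 ∈ ballBoundary n} ∪ ({x | x.2 = 0} ∪ {x | x.2 = 1}) : Set (CWBall n × I)) ↔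
        Φ x ∈ ballBoundary (n + 1) := by
  let K : Set (EuclideanSpace ℝ (Fin n) × ℝ) := Metric.closedBall 0 1 ×ˢ Set.Icc 0 1
  obtain ⟨Φ, hΦ⟩ := exists_homeomorph_convexBody
    (V := EuclideanSpace ℝ (Fin n) × ℝ) (W := EuclideanSpace ℝ (Fin (n + 1))) (by simp)
    (s := K) (t := Metric.closedBall 0 1)
    (Metric.isClosed_closedBall.prod isClosed_Icc) ((convex_closedBall _ _).prod (convex_Icc _ _))
    (Metric.isBounded_closedBall.prod (Metric.isBounded_Icc _ _))
    (by
      rw [interior_prod_eq, interior_Icc, interior_closedBall _ one_ne_zero]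
      exact ⟨(0, 1 / 2), by simp, by norm_num⟩)
    Metric.isClosed_closedBall (convex_closedBall _ _) Metric.isBounded_closedBall
    (by rw [interior_closedBall _ one_ne_zero]; exact ⟨0, by simp⟩)
  refine ⟨(Homeomorph.Set.prod _ _).symm.trans Φ, fun x => ?_⟩
  have := hΦ ((Homeomorph.Set.prod _ _).symm x)
  rw [mem_ballBoundary, Homeomorph.trans_apply, ← mem_sphere_zero_iff_norm,
    ← frontier_closedBall _ one_ne_zero, ← this, frontier_prod_eq, frontier_Icc zero_le_one,
    frontier_closedBall _ one_ne_zero, Metric.isClosed_closedBall.closure_eq, closure_Icc]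
  have h₁ : x.1.1 ∈ Metric.closedBall (0 : EuclideanSpace ℝ (Fin n)) 1 := x.1.2
  have h₂ : x.2.1 ∈ Set.Icc (0 : ℝ) 1 := x.2.2
  have h₃ : (((Homeomorph.Set.prod (Metric.closedBall (0 : EuclideanSpace ℝ (Fin n)) 1)
    (Set.Icc (0 : ℝ) 1)).symm x) : EuclideanSpace ℝ (Fin n) × ℝ) = (x.1.1, x.2.1) := rfl
  rw [h₃]
  simp only [Set.mem_union, Set.mem_prod, h₁, h₂, true_and, and_true, Set.mem_ofPred_eq,
    mem_ballBoundary, mem_sphere_zero_iff_norm, Set.mem_insert_iff, Set.mem_singleton_iff,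
    Subtype.ext_iff, Set.Icc.coe_zero, Set.Icc.coe_one]
  tauto

/-! ### A collapse of the cube onto the ball -/

/-- The cube of dimension `n + 1`, with a distinguished last coordinate. -/
abbrev PrismCube (n : ℕ) : Type := (Fin n → I) × I

/-- The boundary of the cube without the interior of the top face. -/
def prismBox (n : ℕ) : Set (PrismCube n) := {x | x.1 ∈ Cube.boundary (Fin n) ∨ x.2 = 0}

/-- The boundary of the cube. -/
def prismBoundary (n : ℕ) : Set (PrismCube n) := prismBox n ∪ {x | x.2 = 1}

/-- A paraboloid, cut off at height one. -/
def paraboloid (V : Type*) [NormedAddCommGroup V] : Set (V × ℝ) :=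
  {x | ‖x.1‖ ^ 2 ≤ x.2 ∧ x.2 ≤ 1}

section

variable (V : Type*) [NormedAddCommGroup V]

theorem isClosed_paraboloid : IsClosed (paraboloid V) :=
  (isClosed_le (f := fun x : V × ℝ => ‖x.1‖ ^ 2) (by fun_prop) continuous_snd).inter
    (isClosed_le continuous_snd continuous_const)

theorem isBounded_paraboloid : Bornology.IsBounded (paraboloid V) := by
  refine (Metric.isBounded_closedBall (x := (0 : V × ℝ)) (r := 1)).subset fun x hx => ?_
  rw [mem_closedBall_zero_iff, Prod.norm_def, max_le_iff, Real.norm_eq_abs, abs_le]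
  obtain ⟨h₁, h₂⟩ := hx
  have := norm_nonneg x.1
  exact ⟨by nlinarith, by nlinarith, h₂⟩

theorem interior_paraboloid : interior (paraboloid V) = {x | ‖x.1‖ ^ 2 < x.2 ∧ x.2 < 1} := by
  refine subset_antisymm (fun x hx => ?_) (interior_maximal (fun x hx => ⟨hx.1.le, hx.2.le⟩) ?_)
  -- An interior point can be moved slightly up and down, which makes both inequalities strict.
  · have h : IsOpen ((fun t : ℝ => (x.1, t)) ⁻¹' interior (paraboloid V)) :=
      isOpen_interior.preimage (by fun_prop)
    obtain ⟨ε, hε, h⟩ := Metric.isOpen_iff.1 h x.2 hx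
    have h₁ : (x.1, x.2 + ε / 2) ∈ paraboloid V :=
      interior_subset (h (by simp [abs_of_pos hε, hε]))
    have h₂ : (x.1, x.2 - ε / 2) ∈ paraboloid V :=
      interior_subset (h (by simp [abs_of_pos hε, hε]))
    exact ⟨by linarith [h₂.1], by linarith [h₁.2]⟩
  · exact (isOpen_lt (f := fun x : V × ℝ => ‖x.1‖ ^ 2) (by fun_prop) continuous_snd).inter
      (isOpen_lt continuous_snd continuous_const)

theorem mem_frontier_paraboloid {x : V × ℝ} (hx : x ∈ paraboloid V) :
    x ∈ frontier (paraboloid V) ↔ ‖x.1‖ ^ 2 = x.2 ∨ x.2 = 1 := by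
  rw [(isClosed_paraboloid V).frontier_eq, interior_paraboloid, Set.mem_sdiff,
    Set.mem_ofPred_eq, not_and_or, not_lt, not_lt]
  exact ⟨fun h => h.2.imp (fun h => le_antisymm hx.1 h) (fun h => le_antisymm hx.2 h),
    fun h => ⟨hx, h.imp ge_of_eq ge_of_eq⟩⟩

theorem convex_paraboloid [NormedSpace ℝ V] : Convex ℝ (paraboloid V) := by
  rintro x ⟨hx, hx'⟩ y ⟨hy, hy'⟩ a b ha hb hab
  refine ⟨?_, ?_⟩
  · have h : ‖a • x.1 + b • y.1‖ ≤ a * ‖x.1‖ + b * ‖y.1‖ := by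
      refine (norm_add_le _ _).trans_eq ?_
      rw [norm_smul, norm_smul, Real.norm_of_nonneg ha, Real.norm_of_nonneg hb]
    have h' : ‖a • x.1 + b • y.1‖ ^ 2 ≤ (a * ‖x.1‖ + b * ‖y.1‖) ^ 2 := by gcongr
    obtain rfl : b = 1 - a := by linarith
    change ‖a • x.1 + (1 - a) • y.1‖ ^ 2 ≤ a * x.2 + (1 - a) * y.2
    -- Convexity of the square: the defect is `a * b * (‖x.1‖ - ‖y.1‖) ^ 2`.
    nlinarith [mul_nonneg (mul_nonneg ha hb) (sq_nonneg (‖x.1‖ - ‖y.1‖)),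
      mul_le_mul_of_nonneg_left hx ha, mul_le_mul_of_nonneg_left hy hb]
  · change a * x.2 + b * y.2 ≤ 1
    nlinarith

end

/-- The coordinates on the cube for which it is the unit ball of the sup norm. -/
def cubeCenter {n : ℕ} (x : Fin n → I) : Fin n → ℝ := fun i => 2 * (x i : ℝ) - 1

theorem continuous_cubeCenter {n : ℕ} : Continuous (cubeCenter (n := n)) := by
  unfold cubeCenter
  fun_prop

theorem cubeCenter_injective {n : ℕ} : Function.Injective (cubeCenter (n := n)) := by
  intro x y h
  ext i
  have := congrFun h i
  simp only [cubeCenter] at this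
  linarith

theorem norm_cubeCenter_le {n : ℕ} (x : Fin n → I) : ‖cubeCenter x‖ ≤ 1 := by
  rw [pi_norm_le_iff_of_nonneg zero_le_one]
  intro i
  rw [Real.norm_eq_abs, abs_le, cubeCenter]
  constructor <;> linarith [(x i).2.1, (x i).2.2]

theorem exists_cubeCenter_eq {n : ℕ} {v : Fin n → ℝ} (hv : ‖v‖ ≤ 1) : ∃ x, cubeCenter x = v := by
  rw [pi_norm_le_iff_of_nonneg zero_le_one] at hv
  have h (i) := abs_le.1 (hv i)
  refine ⟨fun i => ⟨(v i + 1) / 2, by linarith [(h i).1], by linarith [(h i).2]⟩, ?_⟩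
  ext i
  simp only [cubeCenter]
  ring

theorem norm_cubeCenter_eq_one {n : ℕ} {x : Fin n → I} :
    ‖cubeCenter x‖ = 1 ↔ x ∈ Cube.boundary (Fin n) := by
  constructor
  · intro h
    by_contra hx
    have hx' : ∀ i, x i ≠ 0 ∧ x i ≠ 1 := by
      simpa [Cube.boundary, not_or] using hx
    refine h.not_lt ((pi_norm_lt_iff zero_lt_one).2 fun i => ?_)
    have h0 : 0 < (x i : ℝ) := unitInterval.pos_iff_ne_zero.2 (hx' i).1
    have h1 : (x i : ℝ) < 1 := unitInterval.lt_one_iff_ne_one.2 (hx' i).2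
    rw [Real.norm_eq_abs, abs_lt, cubeCenter]
    constructor <;> linarith
  · rintro ⟨i, hi⟩
    refine le_antisymm (norm_cubeCenter_le x) (le_trans ?_ (norm_le_pi_norm _ i))
    rcases hi with hi | hi <;> (simp [cubeCenter, hi]; try norm_num)

/-- The map of the cube to the paraboloid which collapses `prismBox` to the apex. -/
theorem exists_collapse_paraboloid (n : ℕ) : ∃ c : C(PrismCube n, paraboloid (Fin n → ℝ)),
    Function.Surjective c ∧
    (∀ x, (c x).1 ∈ frontier (paraboloid (Fin n → ℝ)) ↔ x ∈ prismBoundary n) ∧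
    (∀ x ∈ prismBox n, (c x).1 = 0) ∧
    ∀ x y, c x = c y → x = y ∨ x ∈ prismBox n ∧ y ∈ prismBox n := by
  -- In centred coordinates `v` and height `s`, the map is `(v, s) ↦ (s * κ / m * v, s * κ ^ 2)`.
  -- The factor `κ` is 1 for `‖v‖ ≤ 1 / 2` and falls to 0 at the side, so the bottom and the side go
  -- to the apex. On the top face, the inner part `‖v‖ ≤ 1 / 2` covers the flat lid and the outer
  -- part covers the curved wall.
  let ρ : PrismCube n → ℝ := fun x => ‖cubeCenter x.1‖
  let m : PrismCube n → ℝ := fun x => max (ρ x) (1 / 2)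
  let κ : PrismCube n → ℝ := fun x => 2 * (1 - m x)
  have hc := continuous_cubeCenter (n := n)
  have hmc : Continuous m := by fun_prop
  have hm (x) : 1 / 2 ≤ m x := le_max_right _ _
  have hm₀ (x) : 0 < m x := by linarith [hm x]
  have hρ₁ (x) : ρ x ≤ 1 := norm_cubeCenter_le _
  have hρ₀ (x) : 0 ≤ ρ x := norm_nonneg _
  have hρm (x) : ρ x ≤ m x := le_max_left _ _
  have hm₁ (x) : m x ≤ 1 := max_le (hρ₁ x) (by norm_num)
  have hκ₀ (x) : 0 ≤ κ x := by simp only [κ]; linarith [hm₁ x]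
  have hκ₁ (x) : κ x ≤ 1 := by simp only [κ]; linarith [hm x]
  have hcase (x) : (m x = 1 / 2 ∧ κ x = 1 ∧ ρ x ≤ 1 / 2) ∨ m x = ρ x := by
    rcases le_total (ρ x) (1 / 2) with h | h
    · have : m x = 1 / 2 := max_eq_right h
      exact Or.inl ⟨this, by simp only [κ, this]; norm_num, h⟩
    · exact Or.inr (max_eq_left h)
  let w : PrismCube n → (Fin n → ℝ) := fun x => ((x.2 : ℝ) * κ x / m x) • cubeCenter x.1
  let τ : PrismCube n → ℝ := fun x => (x.2 : ℝ) * κ x ^ 2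
  have hs₀ (x : PrismCube n) : (0 : ℝ) ≤ x.2 := x.2.2.1
  have hs₁ (x : PrismCube n) : (x.2 : ℝ) ≤ 1 := x.2.2.2
  have hwn (x) : ‖w x‖ = (x.2 : ℝ) * κ x / m x * ρ x := by
    rw [norm_smul, Real.norm_of_nonneg
      (div_nonneg (mul_nonneg (hs₀ x) (hκ₀ x)) (hm₀ x).le)]
  have hwle (x) : ‖w x‖ ≤ x.2 * κ x := by
    rw [hwn, div_mul_eq_mul_div, div_le_iff₀ (hm₀ x)]
    exact mul_le_mul_of_nonneg_left (hρm x) (mul_nonneg (hs₀ x) (hκ₀ x))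
  have hwsq (x) : ‖w x‖ ^ 2 ≤ (x.2 * κ x) ^ 2 := by
    have := hwle x
    gcongr
  have hwτ (x) : ‖w x‖ ^ 2 ≤ τ x := by
    refine (hwsq x).trans ?_
    simp only [τ]
    rw [mul_pow]
    refine mul_le_mul_of_nonneg_right ?_ (sq_nonneg _)
    nlinarith [hs₀ x, hs₁ x]
  have hτ₁ (x) : τ x ≤ x.2 := by
    refine mul_le_of_le_one_right (hs₀ x) ?_
    exact pow_le_one₀ (hκ₀ x) (hκ₁ x)
  have hbox (x) : x ∈ prismBox n ↔ ρ x = 1 ∨ x.2 = 0 :=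
    or_congr_left norm_cubeCenter_eq_one.symm
  have hbox₀ (x) (hx : x ∈ prismBox n) : (x.2 : ℝ) * κ x = 0 := by
    rcases (hbox x).1 hx with h | h
    · have : m x = 1 := le_antisymm (hm₁ x) (h ▸ hρm x)
      simp [κ, this]
    · simp [h]
  have hboxpos (x) (hx : x ∉ prismBox n) : 0 < (x.2 : ℝ) ∧ 0 < κ x := by
    rw [hbox, not_or] at hx
    refine ⟨unitInterval.pos_iff_ne_zero.2 hx.2, ?_⟩
    have : m x < 1 := max_lt (lt_of_le_of_ne (hρ₁ x) hx.1) (by norm_num)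
    simp only [κ]
    linarith
  have hwc : Continuous w := by
    have : ∀ x, m x ≠ 0 := fun x => (hm₀ _).ne'
    fun_prop (disch := assumption)
  have hτc : Continuous τ := by fun_prop
  have hzero (x) (hx : x ∈ prismBox n) : w x = 0 ∧ τ x = 0 := by
    have := hbox₀ x hx
    refine ⟨by simp only [w]; rw [this]; simp, ?_⟩
    simp only [τ]
    rw [pow_two, ← mul_assoc, this, zero_mul]
  refine ⟨⟨fun x => ⟨(w x, τ x), hwτ x, (hτ₁ x).trans (hs₁ x)⟩, by fun_prop⟩, ?_, ?_, ?_, ?_⟩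
  · rintro ⟨⟨w', t⟩, h₁, h₂⟩
    simp only at h₁ h₂
    suffices ∃ x, w x = w' ∧ τ x = t by
      obtain ⟨x, hx, hx'⟩ := this
      exact ⟨x, Subtype.ext (Prod.ext hx hx')⟩
    have ht₀ : 0 ≤ t := (sq_nonneg _).trans h₁
    have hw₀ := norm_nonneg w'
    rcases ht₀.eq_or_lt with rfl | ht
    · have hw : w' = 0 := by
        rw [← norm_eq_zero]
        nlinarith
      have hx : ((fun _ => 0, 0) : PrismCube n) ∈ prismBox n := Or.inr rfl
      exact ⟨_, (hzero _ hx).1.trans hw.symm, (hzero _ hx).2⟩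
    -- The inner part of the cube fills `‖w'‖ ≤ t`. Elsewhere the norm is `s * κ` and the height is
    -- `s * κ ^ 2`, which forces `κ = t / ‖w'‖` and `s = ‖w'‖ ^ 2 / t`.
    · rcases le_or_gt ‖w'‖ t with h | h
      · have hv : ‖(1 / (2 * t)) • w'‖ ≤ 1 / 2 := by
          rw [norm_smul, Real.norm_of_nonneg (by positivity), div_mul_eq_mul_div, one_mul,
            div_le_iff₀ (by positivity)]
          linarith
        obtain ⟨x, hx⟩ := exists_cubeCenter_eq (hv.trans (by norm_num))
        have hm' : m (x, ⟨t, ht₀, h₂⟩) = 1 / 2 := max_eq_right (by simpa only [ρ, hx] using hv)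
        have hκ' : κ (x, ⟨t, ht₀, h₂⟩) = 1 := by simp only [κ, hm']; norm_num
        refine ⟨(x, ⟨t, ht₀, h₂⟩), ?_, ?_⟩
        · simp only [w, hm', hκ', hx]
          rw [smul_smul]
          convert one_smul ℝ w' using 2
          field_simp
        · simp only [τ, hκ']
          ring
      · have hw : 0 < ‖w'‖ := ht.trans h
        have hk : t / ‖w'‖ ≤ 1 := (div_le_one hw).2 h.le
        have hk₀ : 0 < t / ‖w'‖ := div_pos ht hw
        have hn : ‖((1 - t / ‖w'‖ / 2) / ‖w'‖) • w'‖ = 1 - t / ‖w'‖ / 2 := by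
          rw [norm_smul, Real.norm_of_nonneg (div_nonneg (by linarith) hw.le),
            div_mul_cancel₀ _ hw.ne']
        obtain ⟨x, hx⟩ := exists_cubeCenter_eq (hn.le.trans (by linarith))
        have hs : ‖w'‖ ^ 2 / t ∈ Set.Icc (0 : ℝ) 1 := ⟨by positivity, (div_le_one ht).2 h₁⟩
        have hm' : m (x, ⟨_, hs⟩) = 1 - t / ‖w'‖ / 2 := by
          simp only [m, ρ, hx, hn]
          exact max_eq_left (by linarith)
        have hκ' : κ (x, ⟨_, hs⟩) = t / ‖w'‖ := by simp only [κ, hm']; ring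
        have hne : 1 - t / ‖w'‖ / 2 ≠ 0 := by linarith
        refine ⟨(x, ⟨_, hs⟩), ?_, ?_⟩
        · simp only [w, hm', hκ', hx]
          rw [smul_smul]
          convert one_smul ℝ w' using 2
          rw [div_mul_div_cancel₀ hne]
          field_simp
        · simp only [τ, hκ']
          field_simp
  · intro x
    rw [mem_frontier_paraboloid _ ⟨hwτ x, (hτ₁ x).trans (hs₁ x)⟩]
    change ‖w x‖ ^ 2 = τ x ∨ τ x = 1 ↔ x ∈ prismBox n ∨ x.2 = 1
    constructor
    · intro h
      by_contra! hx
      obtain ⟨h₀, hκ⟩ := hboxpos x hx.1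
      have h₁ : (x.2 : ℝ) < 1 := unitInterval.lt_one_iff_ne_one.2 hx.2
      rcases h with h | h
      · have := hwsq x
        rw [h] at this
        simp only [τ] at this
        have : 0 < (x.2 : ℝ) * (1 - x.2) * κ x ^ 2 :=
          mul_pos (mul_pos h₀ (by linarith)) (by positivity)
        nlinarith
      · linarith [hτ₁ x]
    · rintro (h | h)
      · left
        simp [hzero x h]
      · have h' : (x.2 : ℝ) = 1 := by simp [h]
        rcases hcase x with ⟨-, hk, -⟩ | hk
        · right
          simp [τ, h', hk]
        · left
          rw [hwn, ← hk, div_mul_cancel₀ _ (hm₀ x).ne']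
          simp [τ, h']
  · intro x hx
    exact Prod.ext (hzero x hx).1 (hzero x hx).2
  · intro x y hxy
    have hw : w x = w y := congrArg (fun z => z.1.1) hxy
    have hτ : τ x = τ y := congrArg (fun z => z.1.2) hxy
    have hpos (z) (hz : z ∉ prismBox n) : 0 < τ z :=
      mul_pos (hboxpos z hz).1 (pow_pos (hboxpos z hz).2 2)
    by_cases hx : x ∈ prismBox n
    · by_cases hy : y ∈ prismBox n
      · exact Or.inr ⟨hx, hy⟩
      · have := hpos y hy
        rw [← hτ, (hzero x hx).2] at this
        exact absurd this (lt_irrefl _)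
    · by_cases hy : y ∈ prismBox n
      · have := hpos x hx
        rw [hτ, (hzero y hy).2] at this
        exact absurd this (lt_irrefl _)
      left
      obtain ⟨hx₁, hx₂⟩ := hboxpos x hx
      obtain ⟨hy₁, hy₂⟩ := hboxpos y hy
      have hn := congrArg norm hw
      rw [hwn, hwn] at hn
      simp only [τ] at hτ
      -- equality of heights and norms determines the last coordinate and `κ`
      have hmixed (x y : PrismCube n) (hn : (x.2 : ℝ) * κ x / m x * ρ x = y.2 * κ y / m y * ρ y)
          (hτ : (x.2 : ℝ) * κ x ^ 2 = y.2 * κ y ^ 2) (hy₁ : 0 < (y.2 : ℝ)) (hy₂ : 0 < κ y)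
          (hx : m x = 1 / 2 ∧ κ x = 1 ∧ ρ x ≤ 1 / 2) (hy : m y = ρ y) : κ x = κ y := by
        obtain ⟨hmx, hkx, hrx⟩ := hx
        rw [← hy, div_mul_cancel₀ _ (hm₀ y).ne', hmx, hkx] at hn
        rw [hkx] at hτ ⊢
        -- This yields `κ y * (2 * ρ x) = 1`; as both factors are at most 1, `κ y = 1`.
        have h1 : (y.2 : ℝ) * κ y * (κ y * (2 * ρ x)) = y.2 * κ y * 1 := by
          have h : (x.2 : ℝ) = y.2 * κ y ^ 2 := by linarith
          have h' : (x.2 : ℝ) * 2 * ρ x = y.2 * κ y := by rw [← hn]; ring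
          rw [h] at h'
          linarith
        have h2 := mul_left_cancel₀ (mul_pos hy₁ hy₂).ne' h1
        nlinarith [hκ₁ y, hρ₀ x]
      have hκ : κ x = κ y := by
        rcases hcase x with h | h <;> rcases hcase y with h' | h'
        · rw [h.2.1, h'.2.1]
        · exact hmixed x y hn hτ hy₁ hy₂ h h'
        · exact (hmixed y x hn.symm hτ.symm hx₁ hx₂ h' h).symm
        · rw [← h, ← h', div_mul_cancel₀ _ (hm₀ x).ne', div_mul_cancel₀ _ (hm₀ y).ne'] at hn
          have : (y.2 : ℝ) * κ y * κ x = y.2 * κ y * κ y := by linear_combination hτ - κ x * hn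
          exact mul_left_cancel₀ (mul_pos hy₁ hy₂).ne' this
      have hs : (x.2 : ℝ) = y.2 := by
        rw [hκ] at hτ
        exact mul_right_cancel₀ (pow_pos hy₂ 2).ne' hτ
      have hm' : m x = m y := by
        simp only [κ] at hκ
        linarith
      simp only [w, hs, hκ, hm'] at hw
      have := smul_right_injective _ (div_pos (mul_pos hy₁ hy₂) (hm₀ y)).ne' hw
      exact Prod.ext (cubeCenter_injective this) (Subtype.ext hs)

/-- The ball of dimension `n + 1` is obtained from the cube by collapsing `prismBox` to a point. -/
theorem exists_collapse (n : ℕ) : ∃ c : C(PrismCube n, CWBall (n + 1)),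
    Function.Surjective c ∧ (∀ x, c x ∈ ballBoundary (n + 1) ↔ x ∈ prismBoundary n) ∧
    (∀ x ∈ prismBox n, ∀ y ∈ prismBox n, c x = c y) ∧
    ∀ x y, c x = c y → x = y ∨ x ∈ prismBox n ∧ y ∈ prismBox n := by
  obtain ⟨c, hc, hfr, hbox, hinj⟩ := exists_collapse_paraboloid n
  obtain ⟨Φ, hΦ⟩ := exists_homeomorph_convexBody
    (V := (Fin n → ℝ) × ℝ) (W := EuclideanSpace ℝ (Fin (n + 1))) (by simp)
    (isClosed_paraboloid _) (convex_paraboloid _) (isBounded_paraboloid _)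
    (by rw [interior_paraboloid]; exact ⟨(0, 1 / 2), by norm_num, by norm_num⟩)
    (t := Metric.closedBall 0 1)
    Metric.isClosed_closedBall (convex_closedBall _ _) Metric.isBounded_closedBall
    (by rw [interior_closedBall _ one_ne_zero]; exact ⟨0, by simp⟩)
  refine ⟨⟨fun x => Φ (c x), by fun_prop⟩, Φ.surjective.comp hc, fun x => ?_, fun x hx y hy => ?_,
    fun x y h => hinj x y (Φ.injective h)⟩
  · rw [← hfr, hΦ, mem_ballBoundary, frontier_closedBall _ one_ne_zero, mem_sphere_zero_iff_norm]
    rfl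
  · exact congrArg Φ (Subtype.ext ((hbox x hx).trans (hbox y hy).symm))

/-! ### Lifting along the mapping path fibration of an `n`-equivalence -/

/-- Homotopy groups are defined by cubes, so the problem is pulled back along the collapse, a
quotient map. A solution on the cube descends because on `prismBox` it is the constant path at the
single point `k y`. -/
theorem MapPath.exists_ball_lift_of_cube {Y Z : Type*} [TopologicalSpace Y] [TopologicalSpace Z]
    {k : C(Y, Z)} {n : ℕ}
    (h : ∀ (f : C(PrismCube n, Z)) (g : C(prismBoundary n, Y)) (y : Y), (∀ s, k (g s) = f s) →
      (∀ x (hx : x ∈ prismBox n), g ⟨x, Or.inl hx⟩ = y) →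
      ∃ e : C(PrismCube n, MapPath k), (∀ x, start k (e x) = f x) ∧
        ∀ s : prismBoundary n, e s = const k (g s)) :
    HasLift (start k) (CWBall (n + 1)) (ballBoundary (n + 1)) := by
  refine hasLift_start_of_const fun f g hg => ?_
  obtain ⟨c, hc, hcb, hbox, hinj⟩ := exists_collapse n
  have hq : Topology.IsQuotientMap c := .of_surjective_continuous hc c.continuous
  let g' : C(prismBoundary n, Y) :=
    g.comp ⟨fun x => ⟨c x, (hcb x).2 x.2⟩, by fun_prop⟩
  have h₀ : ((fun _ => 0, 0) : PrismCube n) ∈ prismBox n := Or.inr rfl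
  have hg' (x) (hx : x ∈ prismBox n) : g' ⟨x, Or.inl hx⟩ = g' ⟨_, Or.inl h₀⟩ :=
    congrArg g (Subtype.ext (hbox _ hx _ h₀))
  obtain ⟨e, he, he'⟩ := h (f.comp c) g' _ (fun s => hg _) hg'
  have hfac : Function.FactorsThrough e c := by
    intro x y hxy
    rcases hinj x y hxy with rfl | ⟨hx, hy⟩
    · rfl
    · rw [he' ⟨x, Or.inl hx⟩, he' ⟨y, Or.inl hy⟩, hg' x hx, hg' y hy]
  have hlift (x) : hq.lift e hfac (c x) = e x :=
    congrArg (fun k => k x) (hq.lift_comp e hfac)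
  refine ⟨hq.lift e hfac, fun x => ?_, fun s => ?_⟩
  · obtain ⟨x, rfl⟩ := hc x
    rw [hlift]
    exact he x
  · obtain ⟨s, hs⟩ := s
    obtain ⟨x, rfl⟩ := hc s
    exact (hlift x).trans (he' ⟨x, (hcb x).1 hs⟩)

/-- If `φ` reflects the existence of a path from `a` to `b` and each loop at `φ a` is the image of
a loop at `a` up to homotopy, then each path from `φ a` to `φ b` is the image of a path up to
homotopy. -/
theorem exists_path_map_homotopic {L L' : Type*} [TopologicalSpace L] [TopologicalSpace L']
    (φ : C(L, L')) {a b : L} (hab : Joined (φ a) (φ b) → Joined a b)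
    (hφ : ∀ α : Path (φ a) (φ a), ∃ β : Path a a, (β.map φ.continuous).Homotopic α)
    (ω : Path (φ a) (φ b)) : ∃ γ : Path a b, (γ.map φ.continuous).Homotopic ω := by
  obtain ⟨γ⟩ := hab ⟨ω⟩
  -- The image of `γ` differs from `ω` by a loop at `φ a`; precomposing `γ` with a lift of this loop
  -- corrects it.
  obtain ⟨β, hβ⟩ := hφ (ω.trans (γ.map φ.continuous).symm)
  refine ⟨β.trans γ, ?_⟩
  rw [Path.map_trans]
  refine (hβ.hcomp (.refl _)).trans ?_
  rw [← Path.Homotopic.Quotient.eq]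
  simp only [Path.Homotopic.Quotient.mk_trans, Path.Homotopic.Quotient.mk_symm,
    Path.Homotopic.Quotient.trans_assoc, Path.Homotopic.Quotient.symm_trans,
    Path.Homotopic.Quotient.trans_refl]

/-! ### Homotopy groups through spaces of generalized loops -/

section

variable {Y : Type*} [TopologicalSpace Y] {N : Type*} {y : Y}

/-- A family of maps of cubes that are constant on the boundary gives a map to the space of
generalized loops. -/
def GenLoop.curry {T : Type*} [TopologicalSpace T] (F : C(T × (N → I), Y))
    (hF : ∀ t, ∀ x ∈ Cube.boundary N, F (t, x) = y) : C(T, GenLoop N Y y) :=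
  ⟨fun t => ⟨F.curry t, hF t⟩, F.curry.continuous.subtype_mk _⟩

theorem GenLoop.continuous_eval {T : Type*} [TopologicalSpace T] {p : T → GenLoop N Y y}
    {x : T → N → I} (hp : Continuous p) (hx : Continuous x) : Continuous fun t => p t (x t) :=
  hp.eval hx

theorem GenLoop.joined_iff_homotopic {p q : GenLoop N Y y} :
    Joined p q ↔ GenLoop.Homotopic p q := by
  constructor
  · rintro ⟨γ⟩
    refine ⟨⟨⟨⟨fun t => γ t.1 t.2, continuous_eval (by fun_prop) (by fun_prop)⟩, fun x => ?_,
      fun x => ?_⟩, fun t x hx => ?_⟩⟩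
    · simp
    · simp
    · exact ((γ t).2 x hx).trans (p.2 x hx).symm
  · rintro ⟨H⟩
    refine ⟨⟨curry H.toContinuousMap fun t x hx => (H.eq_fst t hx).trans (p.2 x hx), ?_, ?_⟩⟩
    · ext x
      exact H.apply_zero x
    · ext x
      exact H.apply_one x

end

section

variable {Y Z : Type*} [TopologicalSpace Y] [TopologicalSpace Z] (k : C(Y, Z))

/-- The map of spaces of generalized loops induced by `k`. -/
def GenLoop.mapCM (N : Type*) (y : Y) : C(GenLoop N Y y, GenLoop N Z (k y)) :=
  ⟨fun p => ⟨k.comp p.1, fun x hx => congrArg k (p.2 x hx)⟩,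
    ((ContinuousMap.continuous_postcomp k).comp continuous_subtype_val).subtype_mk _⟩

end

section

variable {Y Z : Type u} [TopologicalSpace Y] [TopologicalSpace Z] {k : C(Y, Z)}

theorem joined_of_homotopyGroupMap_injective {n : ℕ} {y : Y}
    (h : Function.Injective (homotopyGroupMap k n y)) (p q : GenLoop (Fin n) Y y)
    (hpq : Joined (GenLoop.mapCM k (Fin n) y p) (GenLoop.mapCM k (Fin n) y q)) : Joined p q := by
  rw [GenLoop.joined_iff_homotopic] at hpq ⊢
  have : homotopyGroupMap k n y (Quotient.mk _ p) = homotopyGroupMap k n y (Quotient.mk _ q) :=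
    Quotient.sound hpq
  exact Quotient.exact (h this)

/-- A generalized loop of dimension 0 is a point, since the boundary of the 0-cube is empty. This
lets path components serve as `π_0` in the uniform argument for all dimensions. -/
theorem homotopyGroupMap_zero_injective (h : Function.Injective (pathComponentsMap k)) (y : Y) :
    Function.Injective (homotopyGroupMap k 0 y) := by
  intro a b
  induction a using Quotient.inductionOn with | _ p
  induction b using Quotient.inductionOn with | _ q
  intro hpq
  have h₁ : GenLoop.Homotopic (GenLoop.mapCM k (Fin 0) y p) (GenLoop.mapCM k (Fin 0) y q) :=
    Quotient.exact hpq
  rw [← GenLoop.joined_iff_homotopic] at h₁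
  have h₂ : Joined (k (p default)) (k (q default)) :=
    h₁.map (GenLoop.continuous_eval (x := fun _ => default) continuous_id continuous_const)
  have h₃ : pathComponentsMap k (Quotient.mk _ (p default)) =
      pathComponentsMap k (Quotient.mk _ (q default)) := Quotient.sound h₂
  obtain ⟨γ⟩ : Joined (p default) (q default) := Quotient.exact (h h₃)
  refine Quotient.sound (GenLoop.joined_iff_homotopic.1 ⟨⟨GenLoop.curry
    (γ.toContinuousMap.comp ⟨Prod.fst, continuous_fst⟩) fun _ _ ⟨i, _⟩ => i.elim0, ?_, ?_⟩⟩)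
  · ext x
    exact γ.source.trans (congrArg p (Subsingleton.elim _ _))
  · ext x
    exact γ.target.trans (congrArg q (Subsingleton.elim _ _))

/-- A loop at the constant map in the space of `n`-dimensional generalized loops is an `(n +
1)`-dimensional one, with the loop parameter as coordinate 0. A homotopy relative to the boundary of
the cube uncurries to a homotopy of loops relative to the endpoints. -/
theorem exists_loop_map_homotopic {n : ℕ} {y : Y}
    (h : Function.Surjective (homotopyGroupMap k (n + 1) y))
    (α : Path (GenLoop.mapCM k (Fin n) y GenLoop.const) (GenLoop.mapCM k (Fin n) y GenLoop.const)) :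
    ∃ β : Path (GenLoop.const : GenLoop (Fin n) Y y) GenLoop.const,
      (β.map (GenLoop.mapCM k (Fin n) y).continuous).Homotopic α := by
  let a : GenLoop (Fin (n + 1)) Z (k y) :=
    ⟨⟨fun x => α (x 0) (Fin.tail x), GenLoop.continuous_eval (by fun_prop)
      (by unfold Fin.tail; fun_prop)⟩, by
      rintro x ⟨i, hi⟩
      induction i using Fin.cases with
      | zero => rcases hi with hi | hi <;> simp [hi] <;> rfl
      | succ i => exact (α (x 0)).2 _ ⟨i, hi⟩⟩
  have ha (t x) : a (Fin.cons t x) = α t x := by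
    change α ((Fin.cons t x : Fin (n + 1) → I) 0) (Fin.tail (Fin.cons t x : Fin (n + 1) → I)) = _
    rw [Fin.cons_zero, Fin.tail_cons]
  obtain ⟨b, hb⟩ := h (Quotient.mk _ a)
  induction b using Quotient.inductionOn with | _ b
  obtain ⟨H⟩ : GenLoop.Homotopic (GenLoop.mapCM k _ y b) a := Quotient.exact hb
  have hcons : Continuous fun p : I × (Fin n → I) => (Fin.cons p.1 p.2 : Fin (n + 1) → I) := by
    refine continuous_pi fun i => ?_
    induction i using Fin.cases with
    | zero => simpa using continuous_fst
    | succ i => simp only [Fin.cons_succ]; fun_prop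
  have hbd₀ (t : I) (ht : t = 0 ∨ t = 1) (x : Fin n → I) :
      (Fin.cons t x : Fin (n + 1) → I) ∈ Cube.boundary (Fin (n + 1)) := ⟨0, by simpa using ht⟩
  have hbd (t : I) (x : Fin n → I) (hx : x ∈ Cube.boundary (Fin n)) :
      (Fin.cons t x : Fin (n + 1) → I) ∈ Cube.boundary (Fin (n + 1)) := by
    obtain ⟨i, hi⟩ := hx
    exact ⟨i.succ, by simpa using hi⟩
  have hH (u : I) (x) (hx : x ∈ Cube.boundary (Fin (n + 1))) : H (u, x) = k y :=
    (H.eq_fst u hx).trans (congrArg k (b.2 x hx))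
  refine ⟨⟨GenLoop.curry (b.1.comp ⟨_, hcons⟩) fun t x hx => b.2 _ (hbd t x hx), ?_, ?_⟩, ?_⟩
  · ext x
    exact b.2 _ (hbd₀ 0 (Or.inl rfl) x)
  · ext x
    exact b.2 _ (hbd₀ 1 (Or.inr rfl) x)
  let K : C((I × I) × (Fin n → I), Z) := H.toContinuousMap.comp
    (⟨fun q => (q.1.1, Fin.cons q.1.2 q.2), (by fun_prop : Continuous fun q :
      (I × I) × (Fin n → I) => q.1.1).prodMk (hcons.comp (by fun_prop : Continuous fun q :
      (I × I) × (Fin n → I) => (q.1.2, q.2)))⟩ : C((I × I) × (Fin n → I), I × (Fin (n + 1) → I)))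
  refine ⟨⟨⟨GenLoop.curry K fun q x hx => hH _ _ (hbd _ _ hx), fun t => ?_, fun t => ?_⟩,
    fun u t ht => ?_⟩⟩
  · ext x
    exact H.apply_zero _
  · ext x
    exact (H.apply_one _).trans (ha t x)
  · have ht' : t = 0 ∨ t = 1 := ht
    ext x
    exact (hH u _ (hbd₀ t ht' x)).trans (congrArg k (b.2 _ (hbd₀ t ht' x))).symm

/-- Read along the last coordinate, `f` is a path `ω` of generalized loops from the constant one to
the image of the top face `l` of `g`. It is homotopic, relative to the endpoints, to the image of a
path `γ` in `Y`. Then `γ` gives the points in `Y` and the homotopy gives the paths in `Z`, constant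
over the boundary. -/
theorem exists_cube_lift {n : ℕ} {y : Y}
    (hinj : Function.Injective (homotopyGroupMap k n y))
    (hsurj : Function.Surjective (homotopyGroupMap k (n + 1) y))
    (f : C(PrismCube n, Z)) (g : C(prismBoundary n, Y)) (hg : ∀ s, k (g s) = f s)
    (hy : ∀ x (hx : x ∈ prismBox n), g ⟨x, Or.inl hx⟩ = y) :
    ∃ e : C(PrismCube n, MapPath k), (∀ x, MapPath.start k (e x) = f x) ∧
      ∀ s : prismBoundary n, e s = MapPath.const k (g s) := by
  have hf (x) (hx : x ∈ prismBox n) : f x = k y := by rw [← hy x hx, hg]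
  let l : GenLoop (Fin n) Y y := ⟨⟨fun x => g ⟨(x, 1), Or.inr rfl⟩, by fun_prop⟩,
    fun x hx => hy (x, 1) (Or.inl hx)⟩
  let ω : Path (GenLoop.mapCM k (Fin n) y GenLoop.const) (GenLoop.mapCM k (Fin n) y l) :=
    ⟨GenLoop.curry (f.comp ⟨Prod.swap, continuous_swap⟩) fun t x hx => hf (x, t) (Or.inl hx),
      by ext x; exact hf (x, 0) (Or.inr rfl), by ext x; exact (hg ⟨(x, 1), Or.inr rfl⟩).symm⟩
  obtain ⟨γ, ⟨H⟩⟩ := exists_path_map_homotopic (GenLoop.mapCM k (Fin n) y)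
    (joined_of_homotopyGroupMap_injective hinj _ _) (exists_loop_map_homotopic hsurj) ω
  -- `H` runs from the image of `γ` to `ω`, whereas paths in `MapPath k` end at the image of `k`;
  -- hence the reversal.
  obtain ⟨e, he⟩ := MapPath.exists_map (k := k)
    (⟨fun x : PrismCube n => γ x.2 x.1, GenLoop.continuous_eval (by fun_prop) (by fun_prop)⟩ :
      C(PrismCube n, Y))
    (⟨fun q : PrismCube n × I => H (unitInterval.symm q.2, q.1.2) q.1.1,
      GenLoop.continuous_eval (by fun_prop) (by fun_prop)⟩ : C(PrismCube n × I, Z))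
    (fun x => by
      simp only [ContinuousMap.coe_mk, unitInterval.symm_one]
      exact congrArg (fun p : GenLoop (Fin n) Z (k y) => p x.1) (H.apply_zero x.2))
  have hl (x) : l x = g ⟨(x, 1), Or.inr rfl⟩ := rfl
  refine ⟨e, fun x => ?_, ?_⟩
  · refine ((he x).2 0).trans ?_
    simp only [ContinuousMap.coe_mk, unitInterval.symm_zero]
    exact congrArg (fun p : GenLoop (Fin n) Z (k y) => p x.1) (H.apply_one x.2)
  · rintro ⟨⟨x, t⟩, (hx | ht) | ht⟩
    · have h : g ⟨(x, t), Or.inl (Or.inl hx)⟩ = y := hy (x, t) (Or.inl hx)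
      refine MapPath.ext ((he _).1.trans ?_) fun u => ((he _).2 u).trans ?_
      · exact ((γ t).2 x hx).trans h.symm
      · exact ((H (_, t)).2 x hx).trans (congrArg k h).symm
    · obtain rfl : t = 0 := ht
      have h : g ⟨(x, 0), Or.inl (Or.inr rfl)⟩ = y := hy (x, 0) (Or.inr rfl)
      refine MapPath.ext ((he _).1.trans ?_) fun u => ((he _).2 u).trans ?_
      · exact (congrArg (fun p : GenLoop (Fin n) Y y => p x) γ.source).trans h.symm
      · exact (congrArg (fun p : GenLoop (Fin n) Z (k y) => p x) (H.source _)).trans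
          (congrArg k h).symm
    · obtain rfl : t = 1 := ht
      refine MapPath.ext ((he _).1.trans ?_) fun u => ((he _).2 u).trans ?_
      · exact congrArg (fun p : GenLoop (Fin n) Y y => p x) γ.target
      · exact congrArg (fun p : GenLoop (Fin n) Z (k y) => p x) (H.target _)

theorem hasLift_start_zero (h : Function.Surjective (pathComponentsMap k)) :
    HasLift (MapPath.start k) (CWBall 0) (ballBoundary 0) := by
  intro f e he
  have hsub : Subsingleton (CWBall 0) := inferInstance
  obtain ⟨y, hy⟩ := h (Quotient.mk _ (f ⟨0, by simp⟩))
  induction y using Quotient.inductionOn with | _ y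
  obtain ⟨γ⟩ : Joined (k y) (f ⟨0, by simp⟩) := Quotient.exact hy
  refine ⟨ContinuousMap.const _ ⟨(y, γ.symm.toContinuousMap), γ.symm.target⟩, fun x => ?_,
    fun s => ?_⟩
  · refine γ.symm.source.trans (congrArg f (Subsingleton.elim _ _))
  · have := mem_ballBoundary.1 s.2
    rw [Subsingleton.elim s.1.1 0, norm_zero] at this
    exact absurd this zero_ne_one

/-- An `n`-equivalence has the homotopy extension and lifting property for cells of dimension at
most `n`. -/
theorem IsNEquivalence.hasLift_start {n : ℕ∞} (hk : IsNEquivalence n k) {q : ℕ}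
    (hq : (q : ℕ∞) ≤ n) : HasLift (MapPath.start k) (CWBall q) (ballBoundary q) := by
  obtain ⟨h₀, h₀', h⟩ := hk
  cases q with
  | zero =>
    refine hasLift_start_zero ?_
    rcases eq_or_ne n 0 with hn | hn
    · exact h₀' hn
    · exact (h₀ (pos_iff_ne_zero.2 hn)).2
  | succ q =>
    have hqn : (q : ℕ∞) < n := lt_of_lt_of_le (by exact_mod_cast q.lt_succ_self) hq
    refine MapPath.exists_ball_lift_of_cube fun f g y hg hy => exists_cube_lift ?_ ?_ f g hg hy
    · cases q with
      | zero => exact homotopyGroupMap_zero_injective (h₀ hqn).1 y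
      | succ q => exact ((h (q + 1) (by omega) y).1 hqn).1
    · rcases hq.lt_or_eq with hlt | heq
      · exact ((h (q + 1) (by omega) y).1 hlt).2
      · exact (h (q + 1) (by omega) y).2 heq

end

/-! ### Equivariant homotopy classes -/

namespace MMap

variable {M : Type v} [Monoid M] {X Y Z : Type u}
  [TopologicalSpace X] [TopologicalSpace Y] [TopologicalSpace Z]
  [MulAction M X] [MulAction M Y] [MulAction M Z]

theorem map_smul (f : MMap M X Y) (m : M) (x : X) :
    f.toContinuousMap (m • x) = m • f.toContinuousMap x := f.map_smul' m x

/-- A homotopy given as a family of paths. -/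
theorem Homotopic.of_paths {f g : MMap M X Y} (H : C(X × I, Y))
    (h₀ : ∀ x, H (x, 0) = f.toContinuousMap x) (h₁ : ∀ x, H (x, 1) = g.toContinuousMap x)
    (hM : ∀ (m : M) x t, H (m • x, t) = m • H (x, t)) : f.Homotopic g :=
  ⟨⟨⟨H.comp ⟨Prod.swap, continuous_swap⟩, h₀, h₁⟩, fun t m x => hM m x t⟩⟩

/-- Surjectivity for `Z` gives a right inverse `g` up to homotopy. Then `k ∘ (g ∘ k)` and `k` are
homotopic, and injectivity for `Y` cancels `k` on the left. -/
theorem isHomotopyEquiv_of_push (k : MMap M Y Z)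
    (hZ : Function.Surjective (MHomotopyClasses.push Z k))
    (hY : Function.Injective (MHomotopyClasses.push Y k)) : k.IsHomotopyEquiv := by
  obtain ⟨g, hg⟩ := hZ (Quotient.mk _ (MMap.id M Z))
  induction g using Quotient.inductionOn with | _ g
  have h₁ : (k.comp g).Homotopic (MMap.id M Z) := Quotient.exact hg
  refine ⟨g, Quotient.exact (hY ?_), h₁⟩
  obtain ⟨H⟩ := h₁
  refine Quotient.sound (s := MMap.homotopySetoid M Y Z)
    (Homotopic.of_paths (f := k.comp (g.comp k)) (g := k.comp (MMap.id M Y))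
      ⟨fun y => H (y.2, k.toContinuousMap y.1), by fun_prop⟩
      (fun x => H.apply_zero _) (fun x => H.apply_one _) fun m x t => ?_)
  exact (congrArg (fun z => H (t, z)) (k.map_smul m x)).trans (H.prop t m _)

variable [ContinuousConstSMul M Y] [ContinuousConstSMul M Z]

/-- The action on the mapping path space of an equivariant map. -/
abbrev mapPathAction (k : MMap M Y Z) : MulAction M (MapPath k.toContinuousMap) where
  smul m e := ⟨m • e.1, by
    change m • e.1.2 1 = k.toContinuousMap (m • e.1.1)
    rw [k.map_smul, e.2]⟩
  one_smul e := Subtype.ext (one_smul M e.1)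
  mul_smul m m' e := Subtype.ext (mul_smul m m' e.1)

theorem continuousConstSMul_mapPath (k : MMap M Y Z) :
    letI := k.mapPathAction
    ContinuousConstSMul M (MapPath k.toContinuousMap) :=
  letI := k.mapPathAction
  ⟨fun m => (continuous_subtype_val.const_smul m).subtype_mk _⟩

/-- Lift `f` to the mapping path space: the base points form `g`, and the paths are the homotopy. -/
theorem exists_comp_homotopic [ContinuousConstSMul M X] (c : ProjectiveMCWComplex M X)
    (k : MMap M Y Z)
    (hk : ∀ q, Nonempty (c.cell q) →
      HasLift (MapPath.start k.toContinuousMap) (CWBall q) (ballBoundary q))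
    (f : MMap M X Z) : ∃ g : MMap M X Y, f.Homotopic (k.comp g) := by
  let := k.mapPathAction
  have := k.continuousConstSMul_mapPath
  obtain ⟨G, hG, hG'⟩ := c.exists_lift (p := MapPath.start k.toContinuousMap)
    (fun _ _ => rfl) hk f.toContinuousMap f.map_smul
  refine ⟨⟨(MapPath.base _).comp G, fun m x => congrArg (fun e => e.1.1) (hG m x)⟩,
    .of_paths ⟨fun y => (G y.1).1.2 y.2, MapPath.continuous_eval (by fun_prop) (by fun_prop)⟩
      hG' (fun x => (G x).2) fun m x t => congrArg (fun e => e.1.2 t) (hG m x)⟩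

/-- The given homotopy is a family of paths in `Z` whose ends lift to the constant paths at `g₀ x`
and `g₁ x`. Lifting it to a family of paths in the mapping path space and projecting to `Y` gives
the homotopy sought. -/
theorem homotopic_of_comp_homotopic [ContinuousConstSMul M X] (c : ProjectiveMCWComplex M X)
    (k : MMap M Y Z)
    (hk : ∀ q, Nonempty (c.cell q) →
      HasLift (MapPath.start k.toContinuousMap) (CWBall (q + 1)) (ballBoundary (q + 1)))
    {g₀ g₁ : MMap M X Y} (h : (k.comp g₀).Homotopic (k.comp g₁)) : g₀.Homotopic g₁ := by
  let := k.mapPathAction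
  have := k.continuousConstSMul_mapPath
  let s := MapPath.start k.toContinuousMap
  let : MulAction M (PathWithEnds s) :=
    { smul := fun m b => ⟨m • b.1, by
        constructor
        · exact congrArg (m • ·) b.2.1
        · exact congrArg (m • ·) b.2.2⟩
      one_smul := fun b => Subtype.ext (one_smul M b.1)
      mul_smul := fun m m' b => Subtype.ext (mul_smul m m' b.1) }
  have : ContinuousConstSMul M (PathWithEnds s) :=
    ⟨fun m => (continuous_subtype_val.const_smul m).subtype_mk _⟩
  obtain ⟨H⟩ := h
  let K : C(X, C(I, Z)) := (H.toContinuousMap.comp ⟨Prod.swap, continuous_swap⟩).curry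
  let j := MapPath.const k.toContinuousMap
  have hj (m : M) (y : Y) : j (m • y) = m • j y :=
    MapPath.ext rfl fun _ => k.map_smul m y
  let f : C(X, PathWithEnds s) :=
    ⟨fun x => ⟨((j (g₀.toContinuousMap x), j (g₁.toContinuousMap x)), K x),
      (H.apply_zero x).symm, (H.apply_one x).symm⟩,
      Continuous.subtype_mk (by fun_prop) _⟩
  have hf (m : M) (x : X) : f (m • x) = m • f x := by
    refine Subtype.ext (Prod.ext (Prod.ext ?_ ?_) (ContinuousMap.ext fun t => H.prop t m x))
    · exact (congrArg j (g₀.map_smul m x)).trans (hj m _)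
    · exact (congrArg j (g₁.map_smul m x)).trans (hj m _)
  obtain ⟨G, hG, hG'⟩ := c.exists_lift (p := PathWithEnds.ofPath s) (fun _ _ => rfl)
    (fun q hq => by
      obtain ⟨Φ, hΦ⟩ := exists_homeomorph_ball_prod q
      exact PathWithEnds.hasLift_ofPath ((hk q hq).of_homeomorph Φ hΦ)) f hf
  refine .of_paths ⟨fun y => (G y.1 y.2).1.1, ?_⟩ (fun x => ?_) (fun x => ?_) fun m x t => ?_
  · exact (MapPath.base _).continuous.comp (ContinuousMap.continuous_uncurry_of_continuous G)
  · exact congrArg (fun b => b.1.1.1.1.1) (hG' x)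
  · exact congrArg (fun b => b.1.1.2.1.1) (hG' x)
  · exact congrArg (fun γ => (γ t).1.1) (hG m x)

end MMap

/-! ### Dimension bounds and the main theorem -/

theorem ProjectiveMCWComplex.le_dim {M : Type v} [Monoid M] {X : Type u} [TopologicalSpace X]
    [MulAction M X] (c : ProjectiveMCWComplex M X) {q : ℕ} (hq : Nonempty (c.cell q)) :
    ((q : ℕ∞) : WithBot ℕ∞) ≤ c.dim :=
  le_iSup₂ (f := fun (n : ℕ) (_ : n ∈ {n : ℕ | Nonempty (c.cell n)}) =>
    ((n : ℕ∞) : WithBot ℕ∞)) q hq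

section

variable {M : Type v} [Monoid M] {X Y Z : Type u}
  [TopologicalSpace X] [TopologicalSpace Y] [TopologicalSpace Z]
  [MulAction M X] [MulAction M Y] [MulAction M Z] [ContinuousConstSMul M X]
  [ContinuousConstSMul M Y] [ContinuousConstSMul M Z] (c : ProjectiveMCWComplex M X)

theorem push_surjective {n : ℕ∞} {k : MMap M Y Z} (hk : IsNEquivalence n k.toContinuousMap)
    (hn : c.dim ≤ n) : Function.Surjective (MHomotopyClasses.push X k) := by
  intro f
  induction f using Quotient.inductionOn with | _ f
  obtain ⟨g, hg⟩ := MMap.exists_comp_homotopic c k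
    (fun q hq => hk.hasLift_start (WithBot.coe_le_coe.1 ((c.le_dim hq).trans hn))) f
  exact ⟨Quotient.mk _ g, (Quotient.sound (s := MMap.homotopySetoid M X Z) hg).symm⟩

theorem push_bijective {n : ℕ∞} {k : MMap M Y Z} (hk : IsNEquivalence n k.toContinuousMap)
    (hn : c.dim < n ∨ n = ⊤) : Function.Bijective (MHomotopyClasses.push X k) := by
  refine ⟨?_, push_surjective c hk ?_⟩
  · intro a b
    induction a using Quotient.inductionOn with | _ a
    induction b using Quotient.inductionOn with | _ b
    intro hab
    refine Quotient.sound (MMap.homotopic_of_comp_homotopic c k (fun q hq => ?_)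
      (Quotient.exact hab))
    refine hk.hasLift_start ?_
    rcases hn with hn | rfl
    · have : (q : ℕ∞) < n := WithBot.coe_lt_coe.1 ((c.le_dim hq).trans_lt hn)
      -- Homotopies use balls of dimension `q + 1`, so the strict inequality is exactly what is
      -- needed here.
      exact_mod_cast Order.add_one_le_of_lt this
    · exact le_top
  · rcases hn with hn | rfl
    · exact hn.le
    · exact le_top

end

theorem corollaryc (M : Type v) [Monoid M] :
    (∀ (X Y Z : Type u) [TopologicalSpace X] [TopologicalSpace Y] [TopologicalSpace Z]
      [MulAction M X] [MulAction M Y] [MulAction M Z]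
      [ContinuousConstSMul M X] [ContinuousConstSMul M Y] [ContinuousConstSMul M Z]
      (c : ProjectiveMCWComplex M X) (n : ℕ∞) (k : MMap M Y Z),
      IsNEquivalence n k.toContinuousMap →
        (c.dim < (n : WithBot ℕ∞) ∨ n = ⊤ →
          Function.Bijective (MHomotopyClasses.push X k)) ∧
        (c.dim = (n : WithBot ℕ∞) ∧ n < ⊤ →
          Function.Surjective (MHomotopyClasses.push X k))) ∧
    (∀ (Y Z : Type u) [TopologicalSpace Y] [TopologicalSpace Z]
      [MulAction M Y] [MulAction M Z] [ContinuousConstSMul M Y] [ContinuousConstSMul M Z]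
      (cY : ProjectiveMCWComplex M Y) (cZ : ProjectiveMCWComplex M Z) (k : MMap M Y Z),
      (IsWeakEquivalence k.toContinuousMap → k.IsHomotopyEquiv) ∧
      (∀ n : ℕ, IsNEquivalence (n : ℕ∞) k.toContinuousMap →
        cY.dim < (n : WithBot ℕ∞) → cZ.dim < (n : WithBot ℕ∞) → k.IsHomotopyEquiv)) := by
  refine ⟨?_, ?_⟩
  · intro X Y Z _ _ _ _ _ _ _ _ _ c n k hk
    exact ⟨push_bijective c hk, fun h => push_surjective c hk h.1.le⟩
  · intro Y Z _ _ _ _ _ _ cY cZ k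
    refine ⟨fun hk => ?_, fun n hk hY hZ => ?_⟩
    · exact k.isHomotopyEquiv_of_push (push_bijective cZ hk (Or.inr rfl)).2
        (push_bijective cY hk (Or.inr rfl)).1
    · exact k.isHomotopyEquiv_of_push (push_bijective cZ hk (Or.inl hZ)).2
        (push_bijective cY hk (Or.inl hY)).1
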